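/- Let $\mathbb F$ be a field, and write $H_p$ for (unreduced) simplicial homology with coefficients in $\mathbb F$. Let $K$ be a finite abstract simplicial complex with a simplex-wise filtration $\mathcal K$, i.e. $\emptyset=K_0\subseteq K_1\subseteq\dots\subseteq K_m=K$ are simplicial complexes and each $K_{i+1}$ is obtained from $K_i$ by adding at most one simplex. Write $K^{(s)}$ for the set of $s$-simplices of $K$. For a set $A$ of simplices, let $K-A$ be the complex obtained from $K$ by removing all simplices that have a face in $A$ (likewise $K_i-A$), and let $\mathcal K-A=(K_i-A)_i$. Let $\mathrm{PH}_p(\mathcal K)$ be the persistence module over $\mathbb R$ with value $H_p(K_{\lfloor t\rfloor})$ at $t$ (where $K_i=\emptyset$ for $i<0$ and $K_i=K$ for $i>m$) and structure maps induced by inclusion. Let $\mathcal X_{\mathcal K-A\hookrightarrow\mathcal K}$ be the matching, from the barcode of $\mathrm{PH}_p(\mathcal K-A)$ to the barcode of $\mathrm{PH}_p(\mathcal K)$, induced (in the sense of Bauer and Lesnick) by the morphism $\mathrm{PH}_p(\mathcal K-A)\to\mathrm{PH}_p(\mathcal K)$: if $f:M\to N$ is a morphism of persistence modules, then $\mathcal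 X_f$ is the composition of the matching of the barcodes of $M$ and $\operatorname{Im} f$ that pairs the $i$-th longest bars with the same birth, and the matching of the barcodes of $\operatorname{Im} f$ and $N$ that pairs the $i$-th longest bars with the same death. Let $0\le s\le p$ and $k\ge 0$. A bar $B$ of $\mathrm{PH}_p(\mathcal K)$ is $k$-adversarially robust in degree $s$ if $B\in\operatorname{Im}(\mathcal X_{\mathcal K-A\hookrightarrow\mathcal K})$ for every $A\subseteq K^{(s)}$ with $|A|\le k$. A homological $s$-cut of a class $\gamma\in H_p(L)$ in a complex $L$ is a set $C\subseteq L^{(s)}$ such that $\gamma\notin\operatorname{Im}(H_p(L-C)\to H_p(L))$. Let $B=[b,d)$ be a bar in the barcode of $\mathrm{PH}_p(\mathcal K)$ with $d<\infty$. Then $d$ is a positive integer, exactly one simplex $\tau_B$ (the death simplex) is inserted at step $d$, and, with $K_B:=K_{d-1}$ (the predeath complex), $\partial\tau_B$ is a $p$-cycle of $K_B$. Moreover, the following are equivalent: 1. $B$ is $k$-adversarially robust in degree $s$; 2. for every $A\subseteq K^{(s)}$ with $|A|\le k$, the class $[\partial\tau_B]$ lies in $\operatorname{Im}\big(H_p(K_B-A)\to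 H_p(K_B)\big)$; 3. every homological $s$-cut of $[\partial\tau_B]$ in $K_B$ has size greater than $k$. -/

import Mathlib

open CategoryTheory

noncomputable section

namespace AdvRobust

/-! ### Simplicial complexes -/

section Complexes

variable {V : Type*}

/-- The set `K^(s)` of `s`-simplices of `K`. -/
def simplices (K : PreAbstractSimplicialComplex V) (s : ℕ) : Set (Finset V) :=
  {σ | σ ∈ K.faces ∧ σ.card = s + 1}

/-- `K - A`: remove from `K` all simplices that have a face in `A`. -/
def delete (K : PreAbstractSimplicialComplex V) (A : Set (Finset V)) :
    PreAbstractSimplicialComplex V where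
  faces := {σ | σ ∈ K.faces ∧ ∀ a ∈ A, ¬ a ⊆ σ}
  isRelLowerSet_faces := by
    intro σ hσ
    refine ⟨(K.isRelLowerSet_faces hσ.1).1, fun ρ hρ hne => ?_⟩
    exact ⟨(K.isRelLowerSet_faces hσ.1).2 hρ hne, fun a ha h => hσ.2 a ha (h.trans hρ)⟩

theorem delete_le (K : PreAbstractSimplicialComplex V) (A : Set (Finset V)) :
    delete K A ≤ K := fun _ h => h.1

theorem delete_mono {K L : PreAbstractSimplicialComplex V} (h : K ≤ L) (A : Set (Finset V)) :
    delete K A ≤ delete L A := fun _ hσ => ⟨h hσ.1, hσ.2⟩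

end Complexes

/-! ### Simplicial homology over a field -/

section Homology

variable (F : Type*) [Field F] {V : Type*}

/-- Formal `F`-linear combinations of finite sets of vertices. -/
def FormalSum (F : Type*) [Field F] (V : Type*) : Type _ := Finset V →₀ F

instance : AddCommGroup (FormalSum F V) := inferInstanceAs (AddCommGroup (Finset V →₀ F))

instance : Module F (FormalSum F V) := inferInstanceAs (Module F (Finset V →₀ F))

/-- The simplicial `p`-chains `C_p(K; F)`: the combinations of `p`-simplices of `K`. -/
def chains (K : PreAbstractSimplicialComplex V) (p : ℕ) : Submodule F (FormalSum F V) :=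
  (Finsupp.supported F F (simplices K p) : Submodule F (Finset V →₀ F))

theorem chains_mono {K L : PreAbstractSimplicialComplex V} (h : K ≤ L) (p : ℕ) :
    chains F K p ≤ chains F L p :=
  Finsupp.supported_mono fun _ hσ => ⟨h hσ.1, hσ.2⟩

variable [LinearOrder V]

/-- The sign `(-1)^i` of the vertex `v` of `σ`, where `v` is the `i`-th vertex of `σ` (counted
from `0`) in the order of the vertices. -/
def vertexSign (σ : Finset V) (v : V) : F := (-1) ^ (σ.filter (· < v)).card

/-- The boundary `∑ i, (-1)^i [v₀, …, v̂ᵢ, …, v_q]` of the simplex `σ = {v₀ < ⋯ < v_q}`. It is a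
combination of non-empty simplices, so that the boundary of a vertex is zero. -/
def simplexBoundary (σ : Finset V) : FormalSum F V :=
  ∑ v ∈ σ, if (σ.erase v).Nonempty then
    (Finsupp.single (σ.erase v) (vertexSign F σ v) : Finset V →₀ F) else 0

/-- The boundary operator `∑ a_σ σ ↦ ∑ a_σ ∂σ`. -/
def boundary : FormalSum F V →ₗ[F] FormalSum F V :=
  (Finsupp.lsum F fun σ => LinearMap.toSpanSingleton F (FormalSum F V) (simplexBoundary F σ) :
    (Finset V →₀ F) →ₗ[F] FormalSum F V)

/-- The `p`-cycles `Z_p(K; F)`. -/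
def cycles (K : PreAbstractSimplicialComplex V) (p : ℕ) : Submodule F (FormalSum F V) :=
  chains F K p ⊓ LinearMap.ker (boundary F)

/-- The `p`-boundaries `B_p(K; F)`. -/
def boundaries (K : PreAbstractSimplicialComplex V) (p : ℕ) : Submodule F (FormalSum F V) :=
  (chains F K (p + 1)).map (boundary F)

/-- The homology `H_p(K; F) = Z_p(K; F) / B_p(K; F)`. -/
abbrev Homology (K : PreAbstractSimplicialComplex V) (p : ℕ) : Type _ :=
  cycles F K p ⧸ (boundaries F K p).submoduleOf (cycles F K p)

/-- The homology class of a cycle. -/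
def homologyClass (K : PreAbstractSimplicialComplex V) (p : ℕ) (c : FormalSum F V)
    (hc : c ∈ cycles F K p) : Homology F K p :=
  Submodule.Quotient.mk ⟨c, hc⟩

variable {K L M : PreAbstractSimplicialComplex V}

theorem cycles_mono (h : K ≤ L) (p : ℕ) : cycles F K p ≤ cycles F L p :=
  inf_le_inf_right _ (chains_mono F h p)

theorem boundaries_mono (h : K ≤ L) (p : ℕ) : boundaries F K p ≤ boundaries F L p :=
  Submodule.map_mono (chains_mono F h _)

/-- The map `H_p(K) → H_p(L)`, `[c] ↦ [c]`, induced by an inclusion `K ⊆ L`. -/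
def homologyMap (h : K ≤ L) (p : ℕ) : Homology F K p →ₗ[F] Homology F L p :=
  Submodule.mapQ _ _ (Submodule.inclusion (cycles_mono F h p))
    fun _ hc => boundaries_mono F h p hc

theorem homologyMap_refl (p : ℕ) : homologyMap F (le_refl K) p = LinearMap.id := by
  ext x
  rfl

theorem homologyMap_comp (h : K ≤ L) (h' : L ≤ M) (p : ℕ) :
    homologyMap F (h.trans h') p = homologyMap F h' p ∘ₗ homologyMap F h p := by
  ext x
  rfl

/-- `C` is a homological `s`-cut for `γ ∈ H_p(K)`. -/
def IsHomologicalCut (K : PreAbstractSimplicialComplex V) (p s : ℕ) (γ : Homology F K p)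
    (C : Finset (Finset V)) : Prop :=
  (C : Set (Finset V)) ⊆ simplices K s ∧
    γ ∉ LinearMap.range (homologyMap F (delete_le K (C : Set (Finset V))) p)

end Homology

/-! ### Persistence modules and barcodes -/

section Persistence

universe v w w'

variable (F : Type v) [Field F]

/-- Persistence modules over `F`, indexed by `(ℝ, ≤)`. -/
abbrev PersistenceModule := ℝ ⥤ ModuleCat.{w} F

/-- A half-open interval `[birth, death)` of real numbers, where `death` may be infinite. -/
@[ext]
structure Bar where
  birth : ℝ
  death : WithTop ℝ
  birth_lt_death : (birth : WithTop ℝ) < death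

instance : DecidableEq Bar := Classical.decEq _

/-- `I` as a set of real numbers. -/
def Bar.toSet (I : Bar) : Set ℝ := {t | I.birth ≤ t ∧ (t : WithTop ℝ) < I.death}

/-- The value at `t` of the interval module of `I`: `F` if `t ∈ I`, and `0` otherwise. -/
def intervalSpace (I : Bar) (t : ℝ) : Submodule F F where
  carrier := {c | t ∉ I.toSet → c = 0}
  add_mem' := fun ha hb ht => by rw [ha ht, hb ht, add_zero]
  zero_mem' := fun _ => rfl
  smul_mem' := fun a c hc ht => by rw [hc ht, smul_zero]

open scoped Classical in
/-- The map from index `s` to index `t` of the interval module of `I`: the identity of `F` if both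
indices are in `I`, and `0` otherwise. -/
def intervalMap (I : Bar) (s t : ℝ) : intervalSpace F I s →ₗ[F] intervalSpace F I t where
  toFun c := ⟨if t ∈ I.toSet then c else 0, fun ht => if_neg ht⟩
  map_add' a b := by
    ext
    by_cases h : t ∈ I.toSet <;> simp [h]
  map_smul' a b := by
    ext
    by_cases h : t ∈ I.toSet <;> simp [h]

open scoped Classical in
/-- The interval module of `I`. -/
def intervalModule (I : Bar) : PersistenceModule.{v, v} F where
  obj t := ModuleCat.of F (intervalSpace F I t)
  map {s t} _ := ModuleCat.ofHom (intervalMap F I s t)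
  map_id t := by
    ext c
    change (if t ∈ I.toSet then (c : F) else 0) = (c : F)
    split_ifs with h
    · rfl
    · exact (c.2 h).symm
  map_comp {r s t} f g := by
    ext c
    change (if t ∈ I.toSet then (c : F) else 0) =
      if t ∈ I.toSet then (if s ∈ I.toSet then (c : F) else 0) else 0
    split_ifs with ht hs
    · rfl
    · refine c.2 fun hr => hs ⟨hr.1.trans (leOfHom f), lt_of_le_of_lt ?_ ht.2⟩
      exact_mod_cast leOfHom g
    · rfl

variable {F}

/-- The direct sum of a family of persistence modules. -/
def directSumModule {ι : Type w'} (M : ι → PersistenceModule.{v, w} F) :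
    PersistenceModule.{v, max w' w} F where
  obj t := ModuleCat.of F (DirectSum ι fun i => (M i).obj t)
  map f := ModuleCat.ofHom (DirectSum.lmap fun i => ((M i).map f).hom)
  map_id t := by
    ext x
    simp
  map_comp f g := by
    ext x
    simp [DirectSum.lmap_comp]

/-- `M` and `N` are isomorphic: there are linear isomorphisms `M_t ≅ N_t` that commute with the
structure maps. (`M` and `N` may live in different universes.) -/
def Isomorphic (M : PersistenceModule.{v, w} F) (N : PersistenceModule.{v, w'} F) : Prop :=
  ∃ e : ∀ t : ℝ, M.obj t ≃ₗ[F] N.obj t,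
    ∀ (s t : ℝ) (f : s ⟶ t) (x : M.obj s), e t ((M.map f).hom x) = (N.map f).hom (e s x)

/-- The multiset `B` is the barcode of `M`: `M` is isomorphic to the direct sum of the interval
modules of the elements of `B`, counted with multiplicity. -/
def IsBarcode (M : PersistenceModule.{v, w} F) (B : Multiset Bar) : Prop :=
  Isomorphic M (directSumModule fun x : B.ToType => intervalModule F x.1)

open scoped Classical in
/-- The barcode of `M`. It is unique if it exists; if `M` has no finite barcode by half-open
intervals, the value is `0`. -/
def barcode (M : PersistenceModule.{v, w} F) : Multiset Bar :=
  if h : ∃ B, IsBarcode M B then h.choose else 0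

/-- The image of a morphism of persistence modules. -/
def imageModule {M N : PersistenceModule.{v, w} F} (f : M ⟶ N) : PersistenceModule.{v, w} F where
  obj t := ModuleCat.of F (LinearMap.range (f.app t).hom)
  map {s t} g := ModuleCat.ofHom <| (N.map g).hom.restrict <| by
    rintro _ ⟨x, rfl⟩
    exact ⟨(M.map g).hom x, congrArg (fun φ => φ.hom x) (f.naturality g)⟩
  map_id t := by
    ext x
    change (N.map (𝟙 t)).hom x.1 = x.1
    simp
  map_comp g h := by
    ext x
    change (N.map (g ≫ h)).hom x.1 = (N.map h).hom ((N.map g).hom x.1)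
    simp

/-! ### The induced matching

The elements of `B.ToType` are the pairs `(I, j)` with `j` smaller than the multiplicity of `I`, so
that equal bars are told apart by an index. -/

/-- The position of `x` when the bars of `B` with the same birth are ordered by length, the longest
first, and equal bars by their index. -/
def sameBirthPosition (B : Multiset Bar) (x : B.ToType) : ℕ :=
  Set.ncard {y : B.ToType | y.1.birth = x.1.birth ∧
    (x.1.death < y.1.death ∨ (y.1 = x.1 ∧ (y.2 : ℕ) < x.2))}

/-- The position of `x` when the bars of `B` with the same death are ordered by length, the longest
first, and equal bars by their index. -/
def sameDeathPosition (B : Multiset Bar) (x : B.ToType) : ℕ :=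
  Set.ncard {y : B.ToType | y.1.death = x.1.death ∧
    (y.1.birth < x.1.birth ∨ (y.1 = x.1 ∧ (y.2 : ℕ) < x.2))}

/-- The matching of barcodes `B`, `B'` induced by a surjection from a module with barcode `B` to a
module with barcode `B'`: the `i`-th longest bar with birth `b` is matched to the `i`-th longest bar
with birth `b`. -/
def SurjectionMatching (B B' : Multiset Bar) (x : B.ToType) (y : B'.ToType) : Prop :=
  x.1.birth = y.1.birth ∧ sameBirthPosition B x = sameBirthPosition B' y

/-- The matching of barcodes `B`, `B'` induced by an injection from a module with barcode `B` to a
module with barcode `B'`: the `i`-th longest bar with death `d` is matched to the `i`-th longest bar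
with death `d`. -/
def InjectionMatching (B B' : Multiset Bar) (x : B.ToType) (y : B'.ToType) : Prop :=
  x.1.death = y.1.death ∧ sameDeathPosition B x = sameDeathPosition B' y

/-- The matching induced by `f : M ⟶ N`: the composition of the matchings induced by the surjection
from `M` to the image of `f` and by the injection of the image of `f` into `N`. -/
def InducedMatching {M N : PersistenceModule.{v, w} F} (f : M ⟶ N)
    (x : (barcode M).ToType) (z : (barcode N).ToType) : Prop :=
  ∃ y : (barcode (imageModule f)).ToType,
    SurjectionMatching (barcode M) (barcode (imageModule f)) x y ∧
      InjectionMatching (barcode (imageModule f)) (barcode N) y z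

end Persistence

/-! ### Simplex-wise filtrations and adversarial robustness -/

section Filtrations

/-- A simplex-wise filtration `∅ = K_0 ⊆ K_1 ⊆ ⋯ ⊆ K_m = K` of `K`, where `m` is `length` and
`K_i` is `step i`; the sequence is continued by `K_i = K` for `i ≥ m`. -/
structure SimplexwiseFiltration {V : Type*} (K : PreAbstractSimplicialComplex V) where
  length : ℕ
  step : ℕ → PreAbstractSimplicialComplex V
  step_zero : step 0 = ⊥
  step_le_succ : ∀ i, step i ≤ step (i + 1)
  step_eq : ∀ i, length ≤ i → step i = K
  simplexwise : ∀ i, ((step (i + 1)).faces \ (step i).faces).Subsingleton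

namespace SimplexwiseFiltration

variable {V : Type*} {K : PreAbstractSimplicialComplex V}

theorem step_mono (𝒦 : SimplexwiseFiltration K) : Monotone 𝒦.step :=
  monotone_nat_of_le_succ 𝒦.step_le_succ

/-- The filtration `𝒦 - A = (K_i - A)_i` of `K - A`. -/
def delete (𝒦 : SimplexwiseFiltration K) (A : Set (Finset V)) :
    SimplexwiseFiltration (AdvRobust.delete K A) where
  length := 𝒦.length
  step i := AdvRobust.delete (𝒦.step i) A
  step_zero := by
    rw [𝒦.step_zero]
    exact le_bot_iff.mp (delete_le _ _)
  step_le_succ i := delete_mono (𝒦.step_le_succ i) A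
  step_eq i hi := by rw [𝒦.step_eq i hi]
  simplexwise i := fun _ hσ _ hρ =>
    𝒦.simplexwise i ⟨hσ.1.1, fun h => hσ.2 ⟨h, hσ.1.2⟩⟩ ⟨hρ.1.1, fun h => hρ.2 ⟨h, hρ.1.2⟩⟩

variable [LinearOrder V] (F : Type*) [Field F]

/-- The persistent homology `PH_p(𝒦)`, with value `H_p(K_⌊t⌋)` at `t` (for `t < 0` this is
`H_p(K_0) = 0`, by the convention for the natural number `⌊t⌋₊`). -/
def PH (𝒦 : SimplexwiseFiltration K) (p : ℕ) : PersistenceModule F where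
  obj t := ModuleCat.of F (Homology F (𝒦.step ⌊t⌋₊) p)
  map f := ModuleCat.ofHom (homologyMap F (𝒦.step_mono (Nat.floor_mono (leOfHom f))) p)
  map_id t := by
    rw [homologyMap_refl]
    rfl
  map_comp f g := by
    rw [← ModuleCat.ofHom_comp, ← homologyMap_comp]

/-- The morphism `PH_p(𝒦 - A) ⟶ PH_p(𝒦)` induced by inclusion. -/
def deletePHMap (𝒦 : SimplexwiseFiltration K) (p : ℕ) (A : Set (Finset V)) :
    (𝒦.delete A).PH F p ⟶ 𝒦.PH F p where
  app t := ModuleCat.ofHom (homologyMap F (K := (𝒦.delete A).step ⌊t⌋₊) (delete_le (𝒦.step ⌊t⌋₊) A) p)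
  naturality _ _ _ :=
    ModuleCat.hom_ext (Submodule.linearMap_qext _ (LinearMap.ext fun _ => rfl))

/-- The bar `B` of `PH_p(𝒦)` is `k`-adversarially robust in degree `s`: for every set `A` of at most
`k` simplices of dimension `s`, `B` is in the image of the matching induced by
`PH_p(𝒦 - A) ⟶ PH_p(𝒦)`. -/
def IsAdversariallyRobust (𝒦 : SimplexwiseFiltration K) (p k s : ℕ)
    (B : (barcode (𝒦.PH F p)).ToType) : Prop :=
  ∀ A : Finset (Finset V), (A : Set (Finset V)) ⊆ simplices K s → A.card ≤ k →
    ∃ B' : (barcode ((𝒦.delete (A : Set (Finset V))).PH F p)).ToType,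
      InducedMatching (𝒦.deletePHMap F p (A : Set (Finset V))) B' B

/-- The bar `I` dies at step `d`, at which the simplex `τ` is inserted. Then `τ` is the death simplex
of `I`, and `𝒦.step (d - 1)` is its predeath complex. -/
def IsDeathSimplex (𝒦 : SimplexwiseFiltration K) (I : Bar) (d : ℕ) (τ : Finset V) : Prop :=
  I.death = ((d : ℝ) : WithTop ℝ) ∧ 1 ≤ d ∧
    (𝒦.step d).faces \ (𝒦.step (d - 1)).faces = {τ}

end SimplexwiseFiltration

end Filtrations

end AdvRobust

end

/-! Only the simplex τ is inserted between the predeath complex and its successor, so the kernel of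
the map on H_p is spanned by [∂τ] if τ has dimension p + 1 and is zero otherwise
(`eq_zero_or_eq_smul_of_homologyMap_eq_zero`). Every persistence module embedded in PH_p(𝒦) inherits
this bound. In a barcode of such a module, the bars that contain one index but not a later one give
a basis of the kernel of the structure map between the two. Hence at most one bar dies at each step,
and a bar dies at the insertion of τ exactly when the embedded module contains [∂τ] as a nonzero
class that dies there.

This applies to PH_p(𝒦) itself and to the image of PH_p(𝒦 - A). In both, a bar with death d has
position zero among the bars with that death, so the injection half of the matching pairs B with a
bar of the image as soon as the image has one dying at d. The surjection half loses nothing, because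
a surjection does not increase the number of bars with a given birth
(`ncard_birth_le_of_surjective`). So B is matched if and only if [∂τ] comes from the predeath
complex minus A. The reformulation by cuts only replaces A by its intersection with the predeath
complex.

Since `barcode` has a default value, barcodes must be shown to exist: `exists_intervalGenerators`
splits a finite sequence of vector spaces into intervals, and `exists_isBarcode_of_floor` carries
this over to real indices. Uniqueness of barcodes is never needed, as the arguments hold for any
decomposition. -/

noncomputable section

namespace AdvRobust

/-! ### Interval decomposition of finite sequences of vector spaces -/

section Generators

variable {F : Type*} [Field F] {V : ℕ → Type*} [∀ n, AddCommGroup (V n)] [∀ n, Module F (V n)]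

/-- Generators `x i`, born at `β i` and dying at `δ i`, that decompose the family of subspaces `W n`
of `V n` into intervals, for the indices up to `m`. The value `m + 1` of `δ i` stands for a
generator that does not die. -/
structure IntervalGenerators (f : ∀ i j, i ≤ j → V i →ₗ[F] V j) (m : ℕ)
    (W : ∀ n, Submodule F (V n)) (ι : Type) [Fintype ι] where
  β : ι → ℕ
  δ : ι → ℕ
  x : ι → ∀ n, V n
  birth_lt : ∀ i, β i < δ i
  death_le : ∀ i, δ i ≤ m + 1
  mem : ∀ i n, n ≤ m → x i n ∈ W n
  eq_zero : ∀ i n, n ≤ m → ¬ (β i ≤ n ∧ n < δ i) → x i n = 0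
  map_eq : ∀ i n n' (h : n ≤ n'), n' ≤ m → β i ≤ n → n < δ i → f n n' h (x i n) = x i n'
  independent : ∀ n, n ≤ m → ∀ c : ι → F, (∀ i, ¬ (β i ≤ n ∧ n < δ i) → c i = 0) →
    ∑ i, c i • x i n = 0 → c = 0
  span : ∀ n, n ≤ m → ∀ w ∈ W n, ∃ c : ι → F, ∑ i, c i • x i n = w

/-- If `u` is a generator that lives from `i₀` until `d` and `φ` is a compatible family of
functionals that detects it, then the generators of the kernels of `φ` can be extended by `u`. -/
def IntervalGenerators.cons {f : ∀ i j, i ≤ j → V i →ₗ[F] V j} {m : ℕ}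
    {W : ∀ n, Submodule F (V n)} {ι : Type} [Fintype ι] {φ : ∀ n, V n →ₗ[F] F}
    (G : IntervalGenerators f m (fun n => W n ⊓ LinearMap.ker (φ n)) ι)
    (i₀ d : ℕ) (hd : i₀ < d) (hdm : d ≤ m + 1) (u : ∀ n, V n) (hu : ∀ n, u n ∈ W n)
    (hu0 : ∀ n, n ≤ m → ¬ (i₀ ≤ n ∧ n < d) → u n = 0)
    (humap : ∀ n n' (h : n ≤ n'), i₀ ≤ n → f n n' h (u n) = u n')
    (hφ1 : ∀ n, i₀ ≤ n → n < d → φ n (u n) = 1)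
    (hφ0 : ∀ n, n ≤ m → ¬ (i₀ ≤ n ∧ n < d) → ∀ w ∈ W n, φ n w = 0) :
    IntervalGenerators f m W (Option ι) where
  β i := i.elim i₀ G.β
  δ i := i.elim d G.δ
  x i := i.elim u G.x
  birth_lt := by rintro (_ | i); exacts [hd, G.birth_lt i]
  death_le := by rintro (_ | i); exacts [hdm, G.death_le i]
  mem := by rintro (_ | i) n hn; exacts [hu n, (G.mem i n hn).1]
  eq_zero := by rintro (_ | i) n hn h; exacts [hu0 n hn h, G.eq_zero i n hn h]
  map_eq := by
    rintro (_ | i) n n' h hn h1 h2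
    exacts [humap n n' h h1, G.map_eq i n n' h hn h1 h2]
  independent := by
    intro n hn c hc h
    rw [Fintype.sum_option] at h
    -- `φ n` kills the old generators and is 1 on `u n` while `u` lives, so it reads off the
    -- coefficient of `u`.
    have h0 : c none = 0 := by
      by_cases hb : i₀ ≤ n ∧ n < d
      · have h' := congrArg (φ n) h
        have hz : ∀ i, φ n (c (some i) • G.x i n) = 0 := fun i => by
          rw [map_smul, LinearMap.mem_ker.mp (G.mem i n hn).2, smul_zero]
        simpa [hφ1 n hb.1 hb.2, hz, -map_smul] using h'
      · exact hc none hb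
    have h1 := G.independent n hn (fun i => c (some i)) (fun i hi => hc (some i) hi)
      (by simpa [h0] using h)
    funext i
    cases i with
    | none => exact h0
    | some i => exact congrFun h1 i
  span := by
    intro n hn w hw
    obtain ⟨c, hc⟩ := G.span n hn (w - φ n w • u n)
      ⟨sub_mem hw (Submodule.smul_mem _ _ (hu n)), by
        rw [SetLike.mem_coe, LinearMap.mem_ker, map_sub, map_smul]
        by_cases hb : i₀ ≤ n ∧ n < d
        · rw [hφ1 n hb.1 hb.2, smul_eq_mul, mul_one, sub_self]
        · rw [hφ0 n hn hb w hw, zero_smul, sub_self]⟩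
    refine ⟨fun i => i.elim (φ n w) c, ?_⟩
    rw [Fintype.sum_option]
    simp [hc]

/-- Induction on the total dimension, splitting off one interval at a time. A nonzero vector at the
first index where `W` is nonzero is followed until it dies. A functional that detects it at its last
living index, pulled back to the earlier ones, has kernels that are stable under the maps and
complement the orbit. -/
theorem exists_intervalGenerators (f : ∀ i j, i ≤ j → V i →ₗ[F] V j)
    (hid : ∀ i x, f i i le_rfl x = x)
    (hcomp : ∀ i j k (hij : i ≤ j) (hjk : j ≤ k) x,
      f j k hjk (f i j hij x) = f i k (hij.trans hjk) x) (m : ℕ)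
    (W : ∀ n, Submodule F (V n)) (hW : ∀ i j h x, x ∈ W i → f i j h x ∈ W j)
    [hfin : ∀ n, FiniteDimensional F (W n)] :
    ∃ (ι : Type) (_ : Fintype ι), Nonempty (IntervalGenerators f m W ι) := by
  classical
  induction hN : ∑ n ∈ Finset.range (m + 1), Module.finrank F (W n) using Nat.strong_induction_on
    generalizing W with
  | _ N ih =>
  by_cases hbot : ∀ n ≤ m, W n = ⊥
  · refine ⟨Empty, inferInstance, ⟨⟨fun i => i.elim, fun i => i.elim, fun i => i.elim,
      fun i => i.elim, fun i => i.elim, fun i => i.elim, fun i => i.elim, fun i => i.elim,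
      fun _ _ c _ _ => funext fun i => i.elim, fun n hn w hw => ⟨0, ?_⟩⟩⟩⟩
    rw [hbot n hn, Submodule.mem_bot] at hw
    simp [hw]
  push Not at hbot
  set i₀ := Nat.find hbot
  obtain ⟨hi₀m, hne⟩ : i₀ ≤ m ∧ W i₀ ≠ ⊥ := Nat.find_spec hbot
  have hmin : ∀ n < i₀, W n = ⊥ := fun n hn => by
    by_contra h
    exact Nat.find_min hbot hn ⟨by omega, h⟩
  obtain ⟨x, hxW, hx0⟩ := Submodule.exists_mem_ne_zero_of_ne_bot hne
  let u : ∀ n, V n := fun n => if h : i₀ ≤ n then f i₀ n h x else 0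
  have hu : ∀ n (h : i₀ ≤ n), u n = f i₀ n h x := fun n h => dif_pos h
  have hu' : ∀ n, ¬ i₀ ≤ n → u n = 0 := fun n h => dif_neg h
  have huW : ∀ n, u n ∈ W n := fun n => by
    by_cases h : i₀ ≤ n
    · rw [hu n h]; exact hW _ _ _ _ hxW
    · rw [hu' n h]; exact zero_mem _
  have humap : ∀ n n' (h : n ≤ n'), i₀ ≤ n → f n n' h (u n) = u n' := fun n n' h hn => by
    rw [hu n hn, hu n' (hn.trans h), hcomp]
  -- The alternative `m + 1` ends the search when `u` survives up to `m`.
  have hexd : ∃ d, i₀ < d ∧ (d = m + 1 ∨ u d = 0) := ⟨m + 1, by omega, Or.inl rfl⟩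
  set d := Nat.find hexd
  obtain ⟨hd, hdend⟩ : i₀ < d ∧ (d = m + 1 ∨ u d = 0) := Nat.find_spec hexd
  have hdm : d ≤ m + 1 := Nat.find_min' hexd ⟨by omega, Or.inl rfl⟩
  have hune : ∀ n, i₀ ≤ n → n < d → u n ≠ 0 := fun n h1 h2 h0 => by
    rcases h1.eq_or_lt with rfl | h1
    · rw [hu i₀ le_rfl, hid] at h0
      exact hx0 h0
    · exact Nat.find_min hexd h2 ⟨h1, Or.inr h0⟩
  obtain ⟨e, hde⟩ : ∃ e, d = e + 1 := ⟨d - 1, by omega⟩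
  obtain ⟨ψ, hψ⟩ : ∃ ψ : V e →ₗ[F] F, ψ (u e) = 1 := by
    obtain ⟨g, hg⟩ := Module.Projective.exists_dual_ne_zero F (hune e (by omega) (by omega))
    exact ⟨(g (u e))⁻¹ • g, inv_mul_cancel₀ hg⟩
  let φ : ∀ n, V n →ₗ[F] F := fun n => if h : n ≤ e then ψ ∘ₗ f n e h else 0
  have hφ : ∀ n (h : n ≤ e) w, φ n w = ψ (f n e h w) := fun n h w => by
    simp [φ, h]
  have hφ' : ∀ n, ¬ n ≤ e → ∀ w, φ n w = 0 := fun n h w => by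
    simp [φ, h]
  have hφ1 : ∀ n, i₀ ≤ n → n < d → φ n (u n) = 1 := fun n h1 h2 => by
    rw [hφ n (by omega), humap n e _ h1, hψ]
  -- The minimality of `i₀` is essential here: `φ` need not vanish on `V n` for `n < i₀`, but `W n`
  -- is zero there.
  have hφ0 : ∀ n, n ≤ m → ¬ (i₀ ≤ n ∧ n < d) → ∀ w ∈ W n, φ n w = 0 := fun n _ hb w hw => by
    by_cases h : n ≤ e
    · rw [hmin n (by omega), Submodule.mem_bot] at hw
      rw [hw, map_zero]
    · exact hφ' n h w
  have hu0 : ∀ n, n ≤ m → ¬ (i₀ ≤ n ∧ n < d) → u n = 0 := fun n hnm hb => by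
    by_cases h : i₀ ≤ n
    · have hdn : d ≤ n := by omega
      rw [← humap d n hdn hd.le, hdend.resolve_left (by omega), map_zero]
    · exact hu' n h
  let W' : ∀ n, Submodule F (V n) := fun n => W n ⊓ LinearMap.ker (φ n)
  have hfin' : ∀ n, FiniteDimensional F (W' n) := fun n =>
    Submodule.finiteDimensional_of_le inf_le_left
  have hW' : ∀ i j h x, x ∈ W' i → f i j h x ∈ W' j := fun i j h x hx => by
    refine ⟨hW i j h x hx.1, ?_⟩
    rw [SetLike.mem_coe, LinearMap.mem_ker]
    by_cases hj : j ≤ e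
    · rw [hφ j hj, hcomp, ← hφ i (h.trans hj)]
      exact hx.2
    · exact hφ' j hj _
  have hlt : ∑ n ∈ Finset.range (m + 1), Module.finrank F (W' n) < N := by
    rw [← hN]
    refine Finset.sum_lt_sum (fun n _ => Submodule.finrank_mono inf_le_left)
      ⟨i₀, Finset.mem_range.mpr (by omega), Submodule.finrank_lt_finrank_of_lt ?_⟩
    refine lt_of_le_of_ne inf_le_left fun h => ?_
    have h1 : u i₀ ∈ W' i₀ := by rw [h]; exact huW i₀
    exact one_ne_zero ((hφ1 i₀ le_rfl hd).symm.trans h1.2)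
  obtain ⟨ι, hι, ⟨G⟩⟩ := ih _ hlt W' hW' rfl
  exact ⟨Option ι, inferInstance, ⟨G.cons i₀ d hd hdm u huW hu0 humap hφ1 hφ0⟩⟩

end Generators

/-! ### Barcodes from generators, and coordinates from barcodes -/

section Persistence

universe v w

variable {F : Type v} [Field F]

open scoped Classical in
/-- Generators that are supported on intervals and form a basis at each index make a persistence
module isomorphic to a direct sum of interval modules. -/
theorem isomorphic_of_generators (M : PersistenceModule.{v, w} F) {ι κ : Type*} [Fintype ι]
    [Fintype κ] (I : ι → Bar) (y : ι → ∀ t, M.obj t)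
    (hmap : ∀ i (s t : ℝ) (g : s ⟶ t), s ∈ (I i).toSet →
      (M.map g).hom (y i s) = if t ∈ (I i).toSet then y i t else 0)
    (hind : ∀ t, ∀ c : ι → F, (∀ i, t ∉ (I i).toSet → c i = 0) → ∑ i, c i • y i t = 0 → c = 0)
    (hspan : ∀ t w, ∃ c : ι → F, (∀ i, t ∉ (I i).toSet → c i = 0) ∧ ∑ i, c i • y i t = w)
    (J : κ → Bar) (σ : κ ≃ ι) (hσ : ∀ v, I (σ v) = J v) :
    Isomorphic M (directSumModule fun v => intervalModule F (J v)) := by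
  let g : ∀ t, (∀ v : κ, intervalSpace F (J v) t) →ₗ[F] M.obj t := fun t =>
    { toFun := fun c => ∑ v, (c v : F) • y (σ v) t
      map_add' := fun a b => by simp [add_smul, Finset.sum_add_distrib]
      map_smul' := fun r a => by simp [mul_smul, Finset.smul_sum] }
  have hg : ∀ t c, g t c = ∑ v, (c v : F) • y (σ v) t := fun _ _ => rfl
  have hgb : ∀ t, Function.Bijective (g t) := fun t => by
    constructor
    · rw [injective_iff_map_eq_zero]
      intro c hc
      have := hind t (fun i => c (σ.symm i)) (fun i hi => (c (σ.symm i)).2 (by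
          rwa [← hσ, Equiv.apply_symm_apply])) (by
        rw [← hc, hg, ← σ.sum_comp]
        have hcongr : ∀ u v, u = v → (c u : F) = c v := by rintro _ _ rfl; rfl
        exact Finset.sum_congr rfl fun v _ => by rw [hcongr _ _ (σ.symm_apply_apply v)])
      funext v
      have h := congrFun this (σ v)
      rw [Equiv.symm_apply_apply] at h
      exact Subtype.ext h
    · intro w
      obtain ⟨c, hc, rfl⟩ := hspan t w
      refine ⟨fun v => ⟨c (σ v), fun h => hc _ (by rwa [hσ])⟩, ?_⟩
      rw [hg, ← σ.sum_comp]
  let D : ∀ t, (DirectSum κ fun v => intervalSpace F (J v) t) ≃ₗ[F] M.obj t := fun t =>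
    (DirectSum.linearEquivFunOnFintype F κ _).trans (LinearEquiv.ofBijective (g t) (hgb t))
  have hD : ∀ t c, D t c = ∑ v, (c v : F) • y (σ v) t := fun _ _ => rfl
  refine ⟨fun t => (D t).symm, fun s t f z => ?_⟩
  obtain ⟨c, rfl⟩ := (D s).surjective z
  change (D t).symm _ = DirectSum.lmap (fun v => intervalMap F (J v) s t) ((D s).symm _)
  rw [LinearEquiv.symm_apply_apply]
  refine (D t).symm_apply_eq.mpr ?_
  rw [hD, hD, map_sum]
  refine Finset.sum_congr rfl fun v _ => ?_
  rw [map_smul]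
  change _ = ((if t ∈ (J v).toSet then (c v : F) else 0)) • y (σ v) t
  by_cases hs : s ∈ (J v).toSet
  · rw [hmap _ _ _ _ (by rwa [hσ]), hσ]
    split_ifs <;> simp
  · have h0 : (c v : F) = 0 := (c v).2 hs
    rw [h0, ite_self, zero_smul, zero_smul]

open scoped Classical in
/-- A persistence module has a barcode if it has a family of generators that are supported on
intervals and form a basis at each index. -/
theorem isBarcode_of_generators (M : PersistenceModule.{v, w} F) {ι : Type*} [Fintype ι]
    (I : ι → Bar) (y : ι → ∀ t, M.obj t)
    (hmap : ∀ i (s t : ℝ) (g : s ⟶ t), s ∈ (I i).toSet →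
      (M.map g).hom (y i s) = if t ∈ (I i).toSet then y i t else 0)
    (hind : ∀ t, ∀ c : ι → F, (∀ i, t ∉ (I i).toSet → c i = 0) → ∑ i, c i • y i t = 0 → c = 0)
    (hspan : ∀ t w, ∃ c : ι → F, (∀ i, t ∉ (I i).toSet → c i = 0) ∧ ∑ i, c i • y i t = w) :
    IsBarcode M (Finset.univ.val.map I) := by
  -- Multiplicities are one before `I` is applied, so the bars of the image multiset, told apart by
  -- their indices, correspond to `ι` even if `I` is not injective.
  have hcount : ∀ i : ι, (Finset.univ : Finset ι).val.count i = 1 := fun i =>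
    Multiset.count_eq_one_of_mem Finset.univ.nodup (Finset.mem_univ i)
  obtain ⟨σ, hσ⟩ : ∃ σ : (Finset.univ.val.map I).ToType ≃ ι, ∀ v, I (σ v) = v.1 := by
    let σ₀ : (Finset.univ : Finset ι).val.ToType ≃ ι := Equiv.ofBijective (fun v => v.1) <| by
      refine ⟨?_, fun i => ⟨⟨i, ⟨0, by rw [hcount]; exact one_pos⟩⟩, rfl⟩⟩
      rintro ⟨i, a, ha⟩ ⟨j, b, hb⟩ (rfl : i = j)
      rw [hcount] at ha hb
      obtain rfl : a = 0 := by omega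
      obtain rfl : b = 0 := by omega
      rfl
    refine ⟨(Multiset.mapEquiv _ I).symm.trans σ₀, fun v => ?_⟩
    have := Multiset.mapEquiv_apply Finset.univ.val I ((Multiset.mapEquiv _ I).symm v)
    rw [Equiv.apply_symm_apply] at this
    exact this.symm
  exact isomorphic_of_generators M I y hmap hind hspan _ σ hσ

open scoped Classical in
-- The isomorphism is recast as plain coordinate functions, so that later arguments avoid the
-- dependent direct sum.
theorem Isomorphic.exists_coordinates {M : PersistenceModule.{v, w} F} {ι : Type*} [Fintype ι]
    {I : ι → Bar} (h : Isomorphic M (directSumModule fun i => intervalModule F (I i))) :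
    ∃ κ : ∀ t, M.obj t →ₗ[F] (ι → F),
      (∀ t, Function.Injective (κ t)) ∧
      (∀ t z x, t ∉ (I x).toSet → κ t z x = 0) ∧
      (∀ t c, (∀ x : ι, t ∉ (I x).toSet → c x = 0) → ∃ z, κ t z = c) ∧
      ∀ (s t : ℝ) (g : s ⟶ t) z x,
        κ t ((M.map g).hom z) x = if t ∈ (I x).toSet then κ s z x else 0 := by
  obtain ⟨e, he⟩ := h
  refine ⟨fun t =>
    { toFun := fun z x => (show DirectSum ι fun x => intervalSpace F (I x) t from e t z) x
      map_add' := fun a b => by rw [map_add]; rfl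
      map_smul' := fun r a => by rw [map_smul]; rfl }, fun t a b hab => ?_, fun t z x hx => ?_,
      fun t c hc => ?_, fun s t g z x => ?_⟩
  · refine (e t).injective (DFinsupp.ext fun x => Subtype.ext (congrFun hab x))
  · exact ((show DirectSum ι fun x => intervalSpace F (I x) t from e t z) x).2 hx
  · refine ⟨(e t).symm ((DirectSum.linearEquivFunOnFintype F ι
      fun x => intervalSpace F (I x) t).symm fun x => ⟨c x, hc x⟩), ?_⟩
    funext x
    exact (congrArg (fun q : DirectSum ι fun x => intervalSpace F (I x) t => (q x : F))
      ((e t).apply_symm_apply _)).trans (congrArg Subtype.val (congrFun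
        ((DirectSum.linearEquivFunOnFintype F ι
          fun x => intervalSpace F (I x) t).apply_symm_apply fun x => ⟨c x, hc x⟩) x))
  · simp only [LinearMap.coe_mk, AddHom.coe_mk]
    rw [he]
    rfl

open scoped Classical in
/-- The coordinates of the elements of a persistence module with respect to its barcode. -/
theorem IsBarcode.exists_coordinates {M : PersistenceModule.{v, w} F} {B : Multiset Bar}
    (h : IsBarcode M B) :
    ∃ κ : ∀ t, M.obj t →ₗ[F] (B.ToType → F),
      (∀ t, Function.Injective (κ t)) ∧
      (∀ t z x, t ∉ x.1.toSet → κ t z x = 0) ∧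
      (∀ t c, (∀ x : B.ToType, t ∉ x.1.toSet → c x = 0) → ∃ z, κ t z = c) ∧
      ∀ (s t : ℝ) (g : s ⟶ t) z x,
        κ t ((M.map g).hom z) x = if t ∈ x.1.toSet then κ s z x else 0 :=
  Isomorphic.exists_coordinates h

theorem isBarcode_barcode {M : PersistenceModule.{v, w} F} {B : Multiset Bar}
    (h : IsBarcode M B) : IsBarcode M (barcode M) := by
  have h' : ∃ B, IsBarcode M B := ⟨B, h⟩
  rw [barcode, dif_pos h']
  exact h'.choose_spec

end Persistence

section Persistence

universe v w

variable {F : Type v} [Field F] {M N : PersistenceModule.{v, w} F} {B B' : Multiset Bar}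

/-! ### Bars and kernels of structure maps -/

/-- The basis vector at `s` of a bar that does not reach `t` would be killed. -/
theorem IsBarcode.mem_of_injective (hB : IsBarcode M B) {s t : ℝ} (g : s ⟶ t)
    (hg : ∀ z, (M.map g).hom z = 0 → z = 0) {x : B.ToType} (hs : s ∈ x.1.toSet) :
    t ∈ x.1.toSet := by
  classical
  obtain ⟨κ, hinj, h0, hsurj, hmap⟩ := hB.exists_coordinates
  by_contra ht
  obtain ⟨z, hz⟩ := hsurj s (fun y => if y = x then 1 else 0) fun y hy => by
    rw [if_neg]; rintro rfl; exact hy hs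
  have hz0 : z = 0 := hg z <| hinj t <| by
    rw [map_zero]
    funext y
    rw [hmap, hz]
    by_cases hy : y = x
    · subst hy; rw [if_neg ht]; rfl
    · simp [hy]
  have := congrFun hz x
  rw [hz0, map_zero, if_pos rfl] at this
  exact zero_ne_one this

/-- Two distinct bars ending between `s` and `t` would give independent vectors in the kernel; `hg`
says that the kernel is at most one-dimensional. -/
theorem IsBarcode.eq_of_kernel (hB : IsBarcode M B) {s t : ℝ} (g : s ⟶ t)
    (hg : ∀ z z', (M.map g).hom z = 0 → (M.map g).hom z' = 0 →
      ∃ a a' : F, (a ≠ 0 ∨ a' ≠ 0) ∧ a • z + a' • z' = 0)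
    {x y : B.ToType} (hsx : s ∈ x.1.toSet) (hsy : s ∈ y.1.toSet) (htx : t ∉ x.1.toSet)
    (hty : t ∉ y.1.toSet) : x = y := by
  classical
  obtain ⟨κ, hinj, h0, hsurj, hmap⟩ := hB.exists_coordinates
  have key : ∀ u : B.ToType, s ∈ u.1.toSet → t ∉ u.1.toSet →
      ∃ z, κ s z = (fun y => if y = u then 1 else 0) ∧ (M.map g).hom z = 0 := fun u hs ht => by
    obtain ⟨z, hz⟩ := hsurj s (fun y => if y = u then 1 else 0) fun y hy => by
      rw [if_neg]; rintro rfl; exact hy hs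
    refine ⟨z, hz, hinj t ?_⟩
    rw [map_zero]
    funext y
    rw [hmap, hz]
    by_cases hy : y = u
    · subst hy; rw [if_neg ht]; rfl
    · simp [hy]
  obtain ⟨z, hz, hz0⟩ := key x hsx htx
  obtain ⟨z', hz', hz0'⟩ := key y hsy hty
  obtain ⟨a, a', ha, h⟩ := hg z z' hz0 hz0'
  by_contra hxy
  have h1 := congrArg (κ s) h
  rw [map_add, map_smul, map_smul, hz, hz', map_zero] at h1
  have hx := congrFun h1 x
  have hy := congrFun h1 y
  simp only [Pi.add_apply, Pi.smul_apply, if_true, if_neg hxy, if_neg (Ne.symm hxy), smul_eq_mul,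
    mul_one, mul_zero, add_zero, zero_add, Pi.zero_apply] at hx hy
  exact ha.elim (· hx) (· hy)

/-- The structure map preserves the coordinates at bars containing both indices, so a nonzero vector
in the kernel has a nonzero coordinate at a bar that has ended by `t`. -/
theorem IsBarcode.exists_mem_of_kernel (hB : IsBarcode M B) {s t : ℝ} (g : s ⟶ t) {z : M.obj s}
    (hz : z ≠ 0) (hgz : (M.map g).hom z = 0) :
    ∃ x : B.ToType, s ∈ x.1.toSet ∧ t ∉ x.1.toSet := by
  classical
  obtain ⟨κ, hinj, h0, hsurj, hmap⟩ := hB.exists_coordinates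
  by_contra! h
  refine hz (hinj s ?_)
  rw [map_zero]
  funext x
  by_cases hs : s ∈ x.1.toSet
  · have := hmap s t g z x
    rw [hgz, map_zero, if_pos (h x hs)] at this
    exact this.symm
  · exact h0 s z x hs

/-! ### The matching induced by a surjection -/

/-- A surjection of persistence modules does not increase the number of bars with a given birth. -/
theorem ncard_birth_le_of_surjective (hB : IsBarcode M B) (hB' : IsBarcode N B') (g : M ⟶ N)
    (hg : ∀ t, Function.Surjective (g.app t).hom) (b : ℝ) :
    {y : B'.ToType | y.1.birth = b}.ncard ≤ {x : B.ToType | x.1.birth = b}.ncard := by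
  classical
  obtain ⟨κ, hinj, h0, hsurj, hmap⟩ := hB.exists_coordinates
  obtain ⟨κ', hinj', h0', hsurj', hmap'⟩ := hB'.exists_coordinates
  -- As there are finitely many bars, some `s` just before `b` lies after all births of `B` that
  -- precede `b`. What is new in `M` at `b` relative to `s` is then counted by the bars born at `b`.
  obtain ⟨s, hsb, hs⟩ : ∃ s < b, ∀ x : B.ToType, x.1.birth < b → x.1.birth ≤ s := by
    have h1 : ∀ᶠ s in nhdsWithin b (Set.Iio b), ∀ x : B.ToType, x.1.birth < b → x.1.birth ≤ s := by
      refine Filter.eventually_all.mpr fun x => ?_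
      by_cases hx : x.1.birth < b
      · filter_upwards [nhdsWithin_le_nhds (lt_mem_nhds hx)] with s hs _ using le_of_lt hs
      · exact Filter.Eventually.of_forall fun s h => absurd h hx
    obtain ⟨s, hs, hs'⟩ := (h1.and self_mem_nhdsWithin).exists
    exact ⟨s, hs', hs⟩
  let S := {x : B.ToType | x.1.birth = b}
  let S' := {y : B'.ToType | y.1.birth = b}
  let ρ : M.obj b →ₗ[F] (S → F) := LinearMap.funLeft F F Subtype.val ∘ₗ κ b
  let ρ' : N.obj b →ₗ[F] (S' → F) := LinearMap.funLeft F F Subtype.val ∘ₗ κ' b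
  have hρ : ∀ z (x : S), ρ z x = κ b z x.1 := fun _ _ => rfl
  have hρ' : ∀ z (y : S'), ρ' z y = κ' b z y.1 := fun _ _ => rfl
  have hρ's : Function.Surjective ρ' := fun c => by
    obtain ⟨z, hz⟩ := hsurj' b (fun y => if h : y.1.birth = b then c ⟨y, h⟩ else 0) fun y hy => by
      rw [dif_neg]
      rintro rfl
      exact hy ⟨le_rfl, y.1.birth_lt_death⟩
    refine ⟨z, ?_⟩
    funext y
    rw [hρ', hz]
    exact dif_pos y.2
  have hker : ∀ z, ρ z = 0 → ∃ z₀, (M.map (homOfLE hsb.le)).hom z₀ = z := fun z hz => by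
    obtain ⟨z₀, hz₀⟩ := hsurj s (fun x => if s ∈ x.1.toSet then κ b z x else 0)
      fun x hx => if_neg hx
    refine ⟨z₀, hinj b ?_⟩
    funext x
    rw [hmap, hz₀]
    by_cases hb : b ∈ x.1.toSet
    · rw [if_pos hb]
      rcases hb.1.eq_or_lt with h | h
      · have h' : κ b z x = 0 := congrFun hz ⟨x, h⟩
        exact (show (if s ∈ x.1.toSet then κ b z x else 0) = 0 by rw [h', ite_self]).trans h'.symm
      · exact if_pos ⟨hs x h, (WithTop.coe_lt_coe.mpr hsb).trans hb.2⟩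
    · rw [if_neg hb, h0 b z x hb]
  have hker' : ∀ z, ρ' ((N.map (homOfLE hsb.le)).hom z) = 0 := fun z => by
    funext y
    rw [hρ', hmap', h0' s z y.1 fun h => (h.1.trans_lt hsb).ne y.2, ite_self]
    rfl
  -- A section `h` followed by `ρ` is injective: if `ρ (h c) = 0`, then `h c` comes from index `s`,
  -- hence so does its image in `N`, and `ρ'` of that image is both `c` and zero.
  obtain ⟨h, hh⟩ := LinearMap.exists_rightInverse_of_surjective (ρ' ∘ₗ (g.app b).hom)
    (LinearMap.range_eq_top.mpr (hρ's.comp (hg b)))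
  have hle : Module.finrank F (S' → F) ≤ Module.finrank F (S → F) := by
    refine LinearMap.finrank_le_finrank_of_injective (f := ρ ∘ₗ h) ?_
    rw [injective_iff_map_eq_zero]
    intro c hc
    obtain ⟨z₀, hz₀⟩ := hker (h c) hc
    have h1 : ρ' ((g.app b).hom (h c)) = c := LinearMap.congr_fun hh c
    have h2 : (g.app b).hom ((M.map (homOfLE hsb.le)).hom z₀) =
        (N.map (homOfLE hsb.le)).hom ((g.app s).hom z₀) :=
      congrArg (fun φ => φ.hom z₀) (g.naturality (homOfLE hsb.le))
    rw [← h1, ← hz₀, h2, hker']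
  rw [Module.finrank_fintype_fun_eq_card, Module.finrank_fintype_fun_eq_card] at hle
  rw [← Nat.card_coe_set_eq, ← Nat.card_coe_set_eq, Nat.card_eq_fintype_card,
    Nat.card_eq_fintype_card]
  exact hle

/-- In a finite set with a strict total order, the numbers of predecessors are all the numbers
smaller than the number of elements. -/
theorem image_ncard_predecessors {α : Type*} [Finite α] (T : Set α) (r : α → α → Prop)
    (hirr : ∀ a, ¬ r a a) (htrans : ∀ a b c, r a b → r b c → r a c)
    (htot : ∀ a ∈ T, ∀ b ∈ T, a ≠ b → r a b ∨ r b a) :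
    (fun a => {b | b ∈ T ∧ r b a}.ncard) '' T = Set.Iio T.ncard := by
  have hlt : ∀ a ∈ T, ∀ b, r a b → {c | c ∈ T ∧ r c a}.ncard < {c | c ∈ T ∧ r c b}.ncard :=
    fun a ha b hab => Set.ncard_lt_ncard
      ⟨fun c hc => ⟨hc.1, htrans _ _ _ hc.2 hab⟩, fun h => hirr a (h ⟨ha, hab⟩).2⟩
  -- The number of predecessors is strictly increasing along `r`, hence injective on `T`, and its
  -- values are below `T.ncard`; counting gives equality.
  refine Set.eq_of_subset_of_ncard_le ?_ ?_
  · rintro _ ⟨a, ha, rfl⟩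
    exact Set.ncard_lt_ncard ⟨fun c hc => hc.1, fun h => hirr a (h ha).2⟩
  · rw [Set.InjOn.ncard_image]
    · rw [← Finset.coe_Iio, Set.ncard_coe_finset, Nat.card_Iio]
    · intro a ha b hb hab
      by_contra hne
      rcases htot a ha b hb hne with h | h
      · exact (hlt a ha b h).ne hab
      · exact (hlt b hb a h).ne' hab

/-- Bars with equal birth and death are equal intervals, so the index breaks every tie and the order
by length is total. -/
theorem image_sameBirthPosition (B : Multiset Bar) (b : ℝ) :
    sameBirthPosition B '' {x | x.1.birth = b} = Set.Iio {x : B.ToType | x.1.birth = b}.ncard := by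
  rw [← image_ncard_predecessors {x : B.ToType | x.1.birth = b} (fun y x =>
    x.1.death < y.1.death ∨ (y.1 = x.1 ∧ (y.2 : ℕ) < x.2)) ?_ ?_ ?_]
  · refine Set.image_congr fun x hx => ?_
    have hx' : x.1.birth = b := hx
    simp only [sameBirthPosition, Set.mem_ofPred_eq, hx']
  · rintro a (h | h)
    exacts [lt_irrefl _ h, lt_irrefl _ h.2]
  · rintro a b c (h | h) (h' | h')
    · exact Or.inl (h'.trans h)
    · exact Or.inl (h'.1 ▸ h)
    · exact Or.inl (h.1 ▸ h')
    · exact Or.inr ⟨h.1.trans h'.1, h.2.trans h'.2⟩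
  · rintro ⟨I, i⟩ hx ⟨J, j⟩ hy hne
    rcases lt_trichotomy I.death J.death with h | h | h
    · exact Or.inr (Or.inl h)
    · obtain rfl : I = J := Bar.ext (Eq.trans hx (Eq.symm hy)) h
      have hij : (i : ℕ) ≠ j := fun hij => hne (by rw [Fin.ext hij])
      rcases hij.lt_or_gt with h | h
      · exact Or.inl (Or.inr ⟨rfl, h⟩)
      · exact Or.inr (Or.inr ⟨rfl, h⟩)
    · exact Or.inl (Or.inl h)

/-- The matching induced by a surjection reaches every bar of the target. -/
theorem exists_surjectionMatching (hB : IsBarcode M B) (hB' : IsBarcode N B') (g : M ⟶ N)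
    (hg : ∀ t, Function.Surjective (g.app t).hom) (y : B'.ToType) :
    ∃ x : B.ToType, SurjectionMatching B B' x y := by
  have hy : sameBirthPosition B' y ∈ sameBirthPosition B' '' {z | z.1.birth = y.1.birth} :=
    ⟨y, rfl, rfl⟩
  rw [image_sameBirthPosition] at hy
  have hx : sameBirthPosition B' y ∈ sameBirthPosition B '' {x | x.1.birth = y.1.birth} := by
    rw [image_sameBirthPosition]
    exact lt_of_lt_of_le hy (ncard_birth_le_of_surjective hB hB' g hg _)
  obtain ⟨x, hx, hpos⟩ := hx
  exact ⟨x, hx, hpos⟩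

theorem sameDeathPosition_eq_zero {x : B.ToType}
    (h : ∀ y : B.ToType, y.1.death = x.1.death → y = x) : sameDeathPosition B x = 0 := by
  rw [sameDeathPosition, Set.ncard_eq_zero, Set.eq_empty_iff_forall_notMem]
  rintro y ⟨hy, h'⟩
  rw [h y hy] at h'
  exact h'.elim (lt_irrefl _) fun h' => lt_irrefl _ h'.2

/-- The canonical surjection onto the image of a morphism. -/
def toImageModule (f : M ⟶ N) : M ⟶ imageModule f where
  app t := ModuleCat.ofHom (f.app t).hom.rangeRestrict
  naturality s t g := by
    ext x
    exact Subtype.ext (congrArg (fun φ => φ.hom x) (f.naturality g))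

/-- If the bars of the image and the target are determined by their deaths, then a bar of the target
is matched if and only if the image has a bar with the same death. -/
theorem exists_inducedMatching_iff (f : M ⟶ N) (hM : IsBarcode M (barcode M))
    (hI : IsBarcode (imageModule f) (barcode (imageModule f))) (z : (barcode N).ToType)
    (hz : ∀ z' : (barcode N).ToType, z'.1.death = z.1.death → z' = z)
    (hy : ∀ y y' : (barcode (imageModule f)).ToType, y.1.death = z.1.death →
      y'.1.death = z.1.death → y = y') :
    (∃ x, InducedMatching f x z) ↔
      ∃ y : (barcode (imageModule f)).ToType, y.1.death = z.1.death := by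
  constructor
  · rintro ⟨x, y, -, h⟩
    exact ⟨y, h.1⟩
  · rintro ⟨y, h⟩
    -- Every bar of the image is reached from the source, and the uniqueness hypotheses make both
    -- death positions zero.
    obtain ⟨x, hx⟩ := exists_surjectionMatching hM hI (toImageModule f)
      (fun t => LinearMap.surjective_rangeRestrict _) y
    refine ⟨x, y, hx, h, ?_⟩
    rw [sameDeathPosition_eq_zero hz,
      sameDeathPosition_eq_zero fun y' hy' => hy y' y (hy'.trans h) h]

end Persistence

/-! ### Barcodes of modules that depend on the integral part of the index -/

section Persistence

universe v w w'

variable {F : Type v} [Field F]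

/-- A persistence module that depends only on the integral part of the index, vanishes at the index
`0`, is finite-dimensional and constant from some index on has a barcode. -/
theorem exists_isBarcode_of_floor (M : PersistenceModule.{v, w} F) {V : ℕ → Type w'}
    [∀ n, AddCommGroup (V n)] [∀ n, Module F (V n)] (f : ∀ i j, i ≤ j → V i →ₗ[F] V j)
    (hid : ∀ i x, f i i le_rfl x = x)
    (hcomp : ∀ i j k (hij : i ≤ j) (hjk : j ≤ k) x,
      f j k hjk (f i j hij x) = f i k (hij.trans hjk) x)
    (W : ∀ n, Submodule F (V n)) (hW : ∀ i j h x, x ∈ W i → f i j h x ∈ W j)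
    [∀ n, FiniteDimensional F (W n)] (hW0 : W 0 = ⊥) (m : ℕ)
    (hinj : ∀ n (h : m ≤ n), ∀ w ∈ W m, f m n h w = 0 → w = 0)
    (hsurj : ∀ n (h : m ≤ n), ∀ w ∈ W n, ∃ w' ∈ W m, f m n h w' = w)
    (e : ∀ t : ℝ, M.obj t →ₗ[F] V ⌊t⌋₊) (he : ∀ t, Function.Injective (e t))
    (heW : ∀ t w, w ∈ W ⌊t⌋₊ ↔ ∃ z, e t z = w)
    (hnat : ∀ (s t : ℝ) (g : s ⟶ t) z,
      e t ((M.map g).hom z) = f _ _ (Nat.floor_mono (leOfHom g)) (e s z)) :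
    ∃ B, IsBarcode M B := by
  classical
  obtain ⟨ι, _, ⟨G⟩⟩ := exists_intervalGenerators f hid hcomp m W hW
  -- Negative indices also have `⌊t⌋₊ = 0`; positive births are what makes `β ≤ ⌊t⌋₊` equivalent to
  -- `β ≤ t` for all real `t`.
  have hpos : ∀ i, G.β i ≠ 0 := fun i h0 => by
    have h1 : G.x i 0 = 0 := by
      have := G.mem i 0 (Nat.zero_le _)
      rwa [hW0, Submodule.mem_bot] at this
    have h2 := G.independent 0 (Nat.zero_le _) (Pi.single i 1) (fun j hj => by
      rw [Pi.single_apply, if_neg]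
      rintro rfl
      exact hj ⟨h0.le, h0 ▸ G.birth_lt j⟩) (by
      refine Finset.sum_eq_zero fun j _ => ?_
      rw [Pi.single_apply]
      split_ifs with h
      · rw [h, h1, smul_zero]
      · rw [zero_smul])
    have h3 := congrFun h2 i
    rw [Pi.single_eq_same] at h3
    exact one_ne_zero h3
  have hmin : ∀ k n (h : k ≤ n), (k = n ∨ k = m) → ∀ w ∈ W k, f k n h w = 0 → w = 0 := by
    rintro k n h (rfl | rfl) w hw h0
    exacts [(hid k w).symm.trans h0, hinj n h w hw h0]
  have hmin' : ∀ k n (h : k ≤ n), (k = n ∨ k = m) → ∀ w ∈ W n, ∃ w' ∈ W k, f k n h w' = w := by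
    rintro k n h (rfl | rfl) w hw
    exacts [⟨w, hw, hid k w⟩, hsurj n h w hw]
  -- The generators are controlled only up to `m`; beyond it their values at `m` are carried along
  -- maps that are bijective on `W`.
  let y' : ι → ∀ n, V n := fun i n => f (min n m) n (min_le_left _ _) (G.x i (min n m))
  have hy'W : ∀ i n, y' i n ∈ W n := fun i n => hW _ _ _ _ (G.mem i _ (min_le_right _ _))
  choose y hy using fun (i : ι) (t : ℝ) => (heW t _).mp (hy'W i ⌊t⌋₊)
  let I : ι → Bar := fun i =>
    { birth := G.β i
      death := if G.δ i = m + 1 then ⊤ else ((G.δ i : ℝ) : WithTop ℝ)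
      birth_lt_death := by
        split_ifs
        · exact WithTop.coe_lt_top _
        · exact WithTop.coe_lt_coe.mpr (Nat.cast_lt.mpr (G.birth_lt i)) }
  have hI : ∀ i t, t ∈ (I i).toSet ↔ G.β i ≤ min ⌊t⌋₊ m ∧ min ⌊t⌋₊ m < G.δ i := fun i t => by
    have h1 := G.birth_lt i
    have h2 := G.death_le i
    change ((G.β i : ℝ) ≤ t ∧
      (t : WithTop ℝ) < if G.δ i = m + 1 then ⊤ else ((G.δ i : ℝ) : WithTop ℝ)) ↔ _
    rw [← Nat.le_floor_iff' (hpos i)]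
    split_ifs with h
    · simp only [WithTop.coe_lt_top, and_true]
      omega
    · rw [WithTop.coe_lt_coe, ← Nat.floor_lt' (by omega)]
      omega
  have hsum : ∀ t (c : ι → F), e t (∑ i, c i • y i t) =
      f _ _ (min_le_left ⌊t⌋₊ m) (∑ i, c i • G.x i (min ⌊t⌋₊ m)) := fun t c => by
    rw [map_sum, map_sum]
    refine Finset.sum_congr rfl fun i _ => ?_
    rw [map_smul, map_smul, hy]
  refine ⟨_, isBarcode_of_generators M I y (fun i s t g hs => he t ?_) (fun t c hc h0 => ?_)
    fun t w => ?_⟩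
  · rw [hI] at hs
    have hst := Nat.floor_mono (leOfHom g)
    rw [hnat, hy]
    have h1 : f _ _ hst (y' i ⌊s⌋₊) = y' i ⌊t⌋₊ := by
      simp only [y']
      rw [hcomp, ← G.map_eq i (min ⌊s⌋₊ m) (min ⌊t⌋₊ m) (min_le_min_right _ hst)
        (min_le_right _ _) hs.1 hs.2, hcomp]
    rw [h1]
    split_ifs with ht
    · rw [hy]
    · rw [hI] at ht
      rw [map_zero]
      simp only [y']
      rw [G.eq_zero i _ (min_le_right _ _) ht, map_zero]
  · refine G.independent (min ⌊t⌋₊ m) (min_le_right _ _) c (fun i hi => hc i (by rwa [hI])) ?_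
    refine hmin _ _ (min_le_left ⌊t⌋₊ m) (by omega) _
      (sum_mem fun i _ => Submodule.smul_mem _ _ (G.mem i _ (min_le_right _ _))) ?_
    rw [← hsum, h0, map_zero]
  · obtain ⟨w', hw', hw⟩ := hmin' _ _ (min_le_left ⌊t⌋₊ m) (by omega) (e t w)
      ((heW t _).mpr ⟨w, rfl⟩)
    obtain ⟨c, hc⟩ := G.span _ (min_le_right _ _) w' hw'
    refine ⟨fun i => if t ∈ (I i).toSet then c i else 0, fun i hi => if_neg hi, he t ?_⟩
    rw [hsum, ← hw, ← hc]
    congr 1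
    refine Finset.sum_congr rfl fun i _ => ?_
    split_ifs with hi
    · rfl
    · rw [hI] at hi
      rw [G.eq_zero i _ (min_le_right _ _) hi, smul_zero, smul_zero]

end Persistence

/-! ### Simplicial chains and the effect of one new simplex -/

section Homology

variable (F : Type*) [Field F] {V : Type*}

/-- A simplex as a formal sum. -/
def FormalSum.of (σ : Finset V) : FormalSum F V := (Finsupp.single σ 1 : Finset V →₀ F)

variable {F} in
theorem mem_chains {K : PreAbstractSimplicialComplex V} {p : ℕ} {c : FormalSum F V} :
    c ∈ chains F K p ↔ ∀ σ, (show Finset V →₀ F from c) σ ≠ 0 → σ ∈ K.faces ∧ σ.card = p + 1 := by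
  refine (Finsupp.mem_supported F (show Finset V →₀ F from c)).trans ?_
  exact forall_congr' fun σ => imp_congr_left Finsupp.mem_support_iff

theorem of_mem_chains {K : PreAbstractSimplicialComplex V} {p : ℕ} {σ : Finset V}
    (hσ : σ ∈ K.faces) (hcard : σ.card = p + 1) : FormalSum.of F σ ∈ chains F K p :=
  Finsupp.single_mem_supported F 1 ⟨hσ, hcard⟩

/-- The coefficient at `τ` is split off if `τ` is new; otherwise nothing is new and `a = 0`. The
last clause records that `τ` contributes only in its own dimension. -/
theorem exists_eq_add_of_mem_chains {K L : PreAbstractSimplicialComplex V} {q : ℕ} {τ : Finset V}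
    (h : L.faces \ K.faces ⊆ {τ}) {c : FormalSum F V} (hc : c ∈ chains F L q) :
    ∃ c' ∈ chains F K q, ∃ a : F, c = c' + a • FormalSum.of F τ ∧ (a ≠ 0 → τ.card = q + 1) := by
  classical
  by_cases hτ : τ ∈ K.faces
  · refine ⟨c, mem_chains.mpr fun σ hσ => ?_, 0, by rw [zero_smul, add_zero], fun h => absurd rfl h⟩
    have h1 := mem_chains.mp hc σ hσ
    refine ⟨?_, h1.2⟩
    by_contra hK
    have h2 : σ = τ := h ⟨h1.1, hK⟩
    exact hK (h2 ▸ hτ)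
  let c₀ : Finset V →₀ F := c
  refine ⟨(c₀.erase τ : Finset V →₀ F), mem_chains.mpr fun σ hσ => ?_, c₀ τ, ?_,
    fun ha => (mem_chains.mp hc τ ha).2⟩
  · change c₀.erase τ σ ≠ 0 at hσ
    rw [Finsupp.erase_apply] at hσ
    split_ifs at hσ with hστ
    · exact absurd rfl hσ
    · have h1 := mem_chains.mp hc σ hσ
      refine ⟨?_, h1.2⟩
      by_contra hK
      exact hστ (h ⟨h1.1, hK⟩)
  · have h1 : c₀ = c₀.erase τ + c₀ τ • Finsupp.single τ 1 := by
      rw [Finsupp.smul_single_one, Finsupp.erase_add_single]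
    exact h1

theorem finiteDimensional_chains {K : PreAbstractSimplicialComplex V} (hK : K.faces.Finite)
    (p : ℕ) : FiniteDimensional F (chains F K p) := by
  have : Finite (simplices K p) := hK.subset fun σ hσ => hσ.1
  exact Module.Finite.equiv (Finsupp.supportedEquivFinsupp (M := F) (R := F) (simplices K p)).symm

variable [LinearOrder V]

theorem boundary_of (σ : Finset V) : boundary F (FormalSum.of F σ) = simplexBoundary F σ := by
  have : boundary F (FormalSum.of F σ) = (1 : F) • simplexBoundary F σ :=
    Finsupp.lsum_single F _ σ 1
  rw [this, one_smul]

theorem simplexBoundary_eq (σ : Finset V) : simplexBoundary F σ =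
    ∑ v ∈ σ, if (σ.erase v).Nonempty then
      vertexSign F σ v • FormalSum.of F (σ.erase v) else 0 := by
  refine Finset.sum_congr rfl fun v _ => ?_
  congr 1
  exact (Finsupp.smul_single_one (σ.erase v) (vertexSign F σ v)).symm

/-- Removing the smaller vertex shifts the position of the larger one by one, while removing the
larger one does not affect the smaller. -/
theorem vertexSign_mul_vertexSign {σ : Finset V} {v w : V} (hv : v ∈ σ) (hvw : v < w) :
    vertexSign F σ v * vertexSign F (σ.erase v) w +
      vertexSign F σ w * vertexSign F (σ.erase w) v = 0 := by
  have h1 : ((σ.erase w).filter (· < v)) = σ.filter (· < v) := by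
    ext x
    simp only [Finset.mem_filter, Finset.mem_erase]
    exact ⟨fun h => ⟨h.1.2, h.2⟩, fun h => ⟨⟨(h.2.trans hvw).ne, h.1⟩, h.2⟩⟩
  have h2 : (σ.filter (· < w)).card = ((σ.erase v).filter (· < w)).card + 1 := by
    rw [Finset.filter_erase, Finset.card_erase_add_one (Finset.mem_filter.mpr ⟨hv, hvw⟩)]
  simp only [vertexSign]
  rw [h1, h2, pow_succ]
  ring

/-- The terms that remove `v` then `w` and `w` then `v` cancel. The nonemptiness conditions depend
only on the remaining set, so they respect this pairing. -/
theorem boundary_simplexBoundary (σ : Finset V) : boundary F (simplexBoundary F σ) = 0 := by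
  let T : V → V → FormalSum F V := fun v w =>
    if ((σ.erase v).erase w).Nonempty then
      (vertexSign F σ v * vertexSign F (σ.erase v) w) • FormalSum.of F ((σ.erase v).erase w) else 0
  have h1 : boundary F (simplexBoundary F σ) = ∑ v ∈ σ, ∑ w ∈ σ.erase v, T v w := by
    rw [simplexBoundary_eq, map_sum]
    refine Finset.sum_congr rfl fun v _ => ?_
    split_ifs with hne
    · rw [map_smul, boundary_of, simplexBoundary_eq, Finset.smul_sum]
      refine Finset.sum_congr rfl fun w _ => ?_
      simp only [T, smul_ite, smul_zero, mul_smul]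
    · rw [map_zero, Finset.not_nonempty_iff_eq_empty.mp hne, Finset.sum_empty]
  have hT : ∀ v ∈ σ, ∀ w ∈ σ, v ≠ w → T v w + T w v = 0 := by
    have hlt : ∀ v ∈ σ, ∀ w, v < w → T v w + T w v = 0 := fun v hv w hvw => by
      simp only [T]
      rw [Finset.erase_right_comm (a := w)]
      split_ifs with hne
      · rw [← add_smul, vertexSign_mul_vertexSign F hv hvw, zero_smul]
      · exact add_zero 0
    intro v hv w hw hvw
    rcases hvw.lt_or_gt with h | h
    · exact hlt v hv w h
    · rw [add_comm]; exact hlt w hw v h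
  rw [h1, Finset.sum_sigma']
  refine Finset.sum_involution (fun x _ => ⟨x.2, x.1⟩) ?_ ?_ ?_ ?_
  · rintro ⟨v, w⟩ h
    simp only [Finset.mem_sigma, Finset.mem_erase] at h
    exact hT v h.1 w h.2.2 (Ne.symm h.2.1)
  · rintro ⟨v, w⟩ h _ he
    simp only [Finset.mem_sigma, Finset.mem_erase] at h
    exact h.2.1 (congrArg Sigma.fst he)
  · rintro ⟨v, w⟩ h
    simp only [Finset.mem_sigma, Finset.mem_erase] at h ⊢
    exact ⟨h.2.2, Ne.symm h.2.1, h.1⟩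
  · rintro ⟨v, w⟩ _
    rfl

variable {K L : PreAbstractSimplicialComplex V} {p : ℕ}

/-- The proper faces of `τ` lie in `L` and differ from `τ`, so they are already in `K`. -/
theorem simplexBoundary_mem_cycles {τ : Finset V} (h : L.faces \ K.faces = {τ})
    (hcard : τ.card = p + 2) : simplexBoundary F τ ∈ cycles F K p := by
  have hτ : τ ∈ L.faces \ K.faces := h ▸ rfl
  refine ⟨?_, boundary_simplexBoundary F τ⟩
  rw [simplexBoundary_eq]
  refine sum_mem fun v hv => ?_
  split_ifs with hne
  · refine Submodule.smul_mem _ _ (of_mem_chains F ?_ ?_)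
    · by_contra hK
      have h1 : τ.erase v ∈ L.faces \ K.faces :=
        ⟨(L.isRelLowerSet_faces hτ.1).2 (Finset.erase_subset v τ) hne, hK⟩
      rw [h] at h1
      exact Finset.erase_ne_self.mpr hv h1
    · rw [Finset.card_erase_of_mem hv, hcard]
      rfl
  · exact zero_mem _

theorem finiteDimensional_homology (hK : K.faces.Finite) (p : ℕ) :
    FiniteDimensional F (Homology F K p) := by
  have := finiteDimensional_chains F hK p
  have : FiniteDimensional F (cycles F K p) := Submodule.finiteDimensional_of_le inf_le_left
  infer_instance

theorem homologyMap_simplexBoundary (hKL : K ≤ L) {τ : Finset V} (hτL : τ ∈ L.faces)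
    (hcard : τ.card = p + 2) (hτ : simplexBoundary F τ ∈ cycles F K p) :
    homologyMap F hKL p (homologyClass F K p _ hτ) = 0 := by
  refine (Submodule.Quotient.mk_eq_zero _).mpr ?_
  exact ⟨_, of_mem_chains F hτL hcard, boundary_of F τ⟩

/-- If `L` has at most one simplex more than `K`, then the kernel of `H_p(K) → H_p(L)` is spanned by
the boundary of this simplex. -/
theorem eq_zero_or_eq_smul_of_homologyMap_eq_zero (hKL : K ≤ L)
    (hsub : (L.faces \ K.faces).Subsingleton) {z : Homology F K p}
    (hz : homologyMap F hKL p z = 0) :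
    z = 0 ∨ ∃ τ : Finset V, L.faces \ K.faces = {τ} ∧ τ.card = p + 2 ∧
      ∀ hτ : simplexBoundary F τ ∈ cycles F K p, ∃ a : F, z = a • homologyClass F K p _ hτ := by
  obtain ⟨⟨c, hc⟩, rfl⟩ := Submodule.Quotient.mk_surjective _ z
  have hcL : (⟨c, cycles_mono F hKL p hc⟩ : cycles F L p) ∈
      (boundaries F L p).submoduleOf (cycles F L p) := (Submodule.Quotient.mk_eq_zero _).mp hz
  obtain ⟨b, hb, hbc⟩ : c ∈ boundaries F L p := hcL
  rcases hsub.eq_empty_or_singleton with h | ⟨τ, h⟩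
  · refine Or.inl ((Submodule.Quotient.mk_eq_zero _).mpr ⟨b, ?_, hbc⟩)
    exact chains_mono F (fun σ hσ => by
      by_contra hK
      exact (h ▸ (⟨hσ, hK⟩ : σ ∈ L.faces \ K.faces) : σ ∈ (∅ : Set (Finset V)))) _ hb
  -- With `c = ∂b' + a ∂τ` and `b'` in `K`, the class of `c` in `K` is `a [∂τ]`.
  · obtain ⟨b', hb', a, rfl, ha⟩ := exists_eq_add_of_mem_chains F h.subset hb
    by_cases ha0 : a = 0
    · refine Or.inl ((Submodule.Quotient.mk_eq_zero _).mpr ⟨b', hb', ?_⟩)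
      change _ = c
      rw [← hbc, ha0, zero_smul, add_zero]
    · refine Or.inr ⟨τ, h, ha ha0, fun hτ => ⟨a, ?_⟩⟩
      refine (Submodule.Quotient.eq _).mpr ⟨b', hb', ?_⟩
      change _ = c - a • simplexBoundary F τ
      rw [← hbc, map_add, map_smul, boundary_of, add_sub_cancel_right]

/-- If `L` has at most one simplex more than `K`, then the kernel of `H_p(K) → H_p(L)` is at most
one-dimensional. -/
theorem exists_linear_relation_of_homologyMap_eq_zero (hKL : K ≤ L)
    (hsub : (L.faces \ K.faces).Subsingleton) {z z' : Homology F K p}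
    (hz : homologyMap F hKL p z = 0) (hz' : homologyMap F hKL p z' = 0) :
    ∃ a a' : F, (a ≠ 0 ∨ a' ≠ 0) ∧ a • z + a' • z' = 0 := by
  rcases eq_zero_or_eq_smul_of_homologyMap_eq_zero F hKL hsub hz with rfl | ⟨τ, h, hcard, H⟩
  · exact ⟨1, 0, Or.inl one_ne_zero, by rw [smul_zero, zero_smul, add_zero]⟩
  rcases eq_zero_or_eq_smul_of_homologyMap_eq_zero F hKL hsub hz' with rfl | ⟨τ', h', -, H'⟩
  · exact ⟨0, 1, Or.inr one_ne_zero, by rw [smul_zero, zero_smul, add_zero]⟩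
  obtain rfl : τ = τ' := Set.singleton_injective (h.symm.trans h')
  have hτ := simplexBoundary_mem_cycles F h hcard
  obtain ⟨a, rfl⟩ := H hτ
  obtain ⟨a', rfl⟩ := H' hτ
  -- The relation `a' (a [∂τ]) - a (a' [∂τ]) = 0` is certainly nontrivial if `a ≠ 0`; otherwise `z =
  -- 0`.
  by_cases ha : a = 0
  · exact ⟨1, 0, Or.inl one_ne_zero, by rw [ha, zero_smul, smul_zero, zero_smul, add_zero]⟩
  · refine ⟨a', -a, Or.inr (neg_ne_zero.mpr ha), ?_⟩
    rw [smul_smul, smul_smul, ← add_smul, neg_mul, mul_comm a, add_neg_cancel, zero_smul]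

end Homology

/-! ### Homology of equal complexes -/

section Homology

variable (F : Type*) [Field F] {V : Type*} [LinearOrder V]

theorem homologyMap_homologyMap {K L M : PreAbstractSimplicialComplex V} (h : K ≤ L) (h' : L ≤ M)
    {p : ℕ} (x : Homology F K p) :
    homologyMap F h' p (homologyMap F h p x) = homologyMap F (h.trans h') p x := by
  rw [homologyMap_comp F h h', LinearMap.comp_apply]

theorem homology_eq_zero_of_eq_bot {K : PreAbstractSimplicialComplex V} (hK : K = ⊥) {p : ℕ}
    (z : Homology F K p) : z = 0 := by
  subst hK
  obtain ⟨⟨c, hc⟩, rfl⟩ := Submodule.Quotient.mk_surjective _ z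
  have h0 : c = 0 := Finsupp.ext fun σ => by
    by_contra h
    exact (mem_chains.mp hc.1 σ h).1
  subst h0
  exact Submodule.Quotient.mk_zero _

theorem homologyMap_injective_of_eq {K L : PreAbstractSimplicialComplex V} (h : K ≤ L)
    (hKL : K = L) {p : ℕ} {z : Homology F K p} (hz : homologyMap F h p z = 0) : z = 0 := by
  subst hKL
  rwa [homologyMap_refl] at hz

/-- The submodule is given for all complexes at once so that it follows the substitution of `K` for
`L`. -/
theorem exists_homologyMap_eq_of_eq {K L : PreAbstractSimplicialComplex V} (h : K ≤ L)
    (hKL : K = L) {p : ℕ} (R : ∀ K : PreAbstractSimplicialComplex V, Submodule F (Homology F K p))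
    {w : Homology F L p} (hw : w ∈ R L) : ∃ w' ∈ R K, homologyMap F h p w' = w := by
  subst hKL
  exact ⟨w, hw, by rw [homologyMap_refl]; rfl⟩

end Homology

section Complexes

variable {V : Type*}

/-- Removing only the simplices of `A` that lie in `K` has the same effect as removing `A`. -/
theorem delete_inter_faces (K : PreAbstractSimplicialComplex V) {A : Set (Finset V)}
    (hA : ∀ a ∈ A, a.Nonempty) : delete K (A ∩ K.faces) = delete K A := by
  refine le_antisymm (fun σ hσ => ⟨hσ.1, fun a ha haσ => ?_⟩)
    fun σ hσ => ⟨hσ.1, fun a ha => hσ.2 a ha.1⟩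
  exact hσ.2 a ⟨ha, (K.isRelLowerSet_faces hσ.1).2 haσ (hA a ha)⟩ haσ

end Complexes

/-! ### Deaths in modules embedded in persistent homology -/

namespace SimplexwiseFiltration

variable {V : Type*} {K : PreAbstractSimplicialComplex V}

theorem step_le (𝒦 : SimplexwiseFiltration K) (n : ℕ) : 𝒦.step n ≤ K :=
  (𝒦.step_mono (le_max_left n 𝒦.length)).trans (𝒦.step_eq _ (le_max_right _ _)).le

theorem finite_faces_step (𝒦 : SimplexwiseFiltration K) (n : ℕ) : (𝒦.step n).faces.Finite := by
  induction n with
  | zero =>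
    rw [𝒦.step_zero]
    exact Set.finite_empty
  | succ n ih =>
    refine (ih.union (𝒦.simplexwise n).finite).subset fun σ hσ => ?_
    by_cases h : σ ∈ (𝒦.step n).faces
    exacts [Or.inl h, Or.inr ⟨hσ, h⟩]

theorem subsingleton_faces_diff (𝒦 : SimplexwiseFiltration K) {s : ℝ} {d : ℕ} (hd : ⌊s⌋₊ + 1 = d) :
    ((𝒦.step ⌊(d : ℝ)⌋₊).faces \ (𝒦.step ⌊s⌋₊).faces).Subsingleton := by
  rw [Nat.floor_natCast, ← hd]
  exact 𝒦.simplexwise _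

variable [LinearOrder V] {F : Type*} [Field F]

/-- A persistence module that embeds into the persistent homology of `𝒦`. -/
structure HomologyEmbedding (𝒦 : SimplexwiseFiltration K) (p : ℕ) (M : PersistenceModule F) where
  toFun : ∀ t : ℝ, M.obj t →ₗ[F] Homology F (𝒦.step ⌊t⌋₊) p
  injective : ∀ t, Function.Injective (toFun t)
  natural : ∀ (s t : ℝ) (g : s ⟶ t) z, toFun t ((M.map g).hom z) =
    homologyMap F (𝒦.step_mono (Nat.floor_mono (leOfHom g))) p (toFun s z)

variable (F) in
/-- The persistent homology embeds into itself. -/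
def phEmbedding (𝒦 : SimplexwiseFiltration K) (p : ℕ) : 𝒦.HomologyEmbedding p (𝒦.PH F p) where
  toFun _ := LinearMap.id
  injective _ := Function.injective_id
  natural _ _ _ _ := rfl

variable (F) in
/-- The image of `PH_p(𝒦 - A)` embeds into `PH_p(𝒦)`. -/
def imageEmbedding (𝒦 : SimplexwiseFiltration K) (p : ℕ) (A : Set (Finset V)) :
    𝒦.HomologyEmbedding p (imageModule (𝒦.deletePHMap F p A)) where
  toFun t := (LinearMap.range (homologyMap F (delete_le (𝒦.step ⌊t⌋₊) A) p)).subtype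
  injective _ := Subtype.val_injective
  natural _ _ _ _ := rfl

variable {𝒦 : SimplexwiseFiltration K} {p : ℕ} {M : PersistenceModule F}

/-- `R` describes the image of the embedding as a functorial submodule of homology. It is everything
for PH_p(𝒦), and the classes coming from `L - A` for the image module. -/
theorem HomologyEmbedding.exists_isBarcode (E : 𝒦.HomologyEmbedding p M)
    (R : ∀ L : PreAbstractSimplicialComplex V, Submodule F (Homology F L p))
    (hR : ∀ L L' (h : L ≤ L'), ∀ z ∈ R L, homologyMap F h p z ∈ R L')
    (hER : ∀ t w, w ∈ R (𝒦.step ⌊t⌋₊) ↔ ∃ z, E.toFun t z = w) : ∃ B, IsBarcode M B := by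
  have hfin : ∀ n, FiniteDimensional F (Homology F (𝒦.step n) p) := fun n =>
    finiteDimensional_homology F (𝒦.finite_faces_step n) p
  have heq : ∀ n, 𝒦.length ≤ n → 𝒦.step 𝒦.length = 𝒦.step n := fun n hn => by
    rw [𝒦.step_eq _ le_rfl, 𝒦.step_eq _ hn]
  exact exists_isBarcode_of_floor M (V := fun n => Homology F (𝒦.step n) p)
    (fun i j h => homologyMap F (𝒦.step_mono h) p)
    (fun i x => by rw [homologyMap_refl]; rfl)
    (fun i j k hij hjk x => homologyMap_homologyMap F _ _ x)
    (fun n => R (𝒦.step n)) (fun i j h x hx => hR _ _ _ x hx)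
    ((Submodule.eq_bot_iff _).mpr fun z _ => homology_eq_zero_of_eq_bot F 𝒦.step_zero z)
    𝒦.length (fun n h w _ hw => homologyMap_injective_of_eq F _ (heq n h) hw)
    (fun n h w hw => exists_homologyMap_eq_of_eq F _ (heq n h) R hw)
    E.toFun E.injective hER E.natural

theorem isBarcode_PH (𝒦 : SimplexwiseFiltration K) (p : ℕ) :
    IsBarcode (𝒦.PH F p) (barcode (𝒦.PH F p)) := by
  obtain ⟨B, hB⟩ := (𝒦.phEmbedding F p).exists_isBarcode (fun _ => ⊤)
    (fun _ _ _ _ _ => Submodule.mem_top) fun t w => ⟨fun _ => ⟨w, rfl⟩, fun _ => Submodule.mem_top⟩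
  exact isBarcode_barcode hB

theorem isBarcode_imageModule (𝒦 : SimplexwiseFiltration K) (p : ℕ) (A : Set (Finset V)) :
    IsBarcode (imageModule (𝒦.deletePHMap F p A))
      (barcode (imageModule (𝒦.deletePHMap F p A))) := by
  obtain ⟨B, hB⟩ := (𝒦.imageEmbedding F p A).exists_isBarcode
    (fun L => LinearMap.range (homologyMap F (delete_le L A) p))
    (by
      rintro L L' h _ ⟨z, rfl⟩
      refine ⟨homologyMap F (delete_mono h A) p z, ?_⟩
      rw [homologyMap_homologyMap, homologyMap_homologyMap])
    fun t w => ⟨fun hw => ⟨⟨w, hw⟩, rfl⟩, by rintro ⟨z, rfl⟩; exact z.2⟩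
  exact isBarcode_barcode hB

namespace HomologyEmbedding

variable {B : Multiset Bar}

/-- Finite deaths are positive integers. -/
theorem exists_death_eq (E : 𝒦.HomologyEmbedding p M) (hB : IsBarcode M B) (x : B.ToType)
    (hx : x.1.death ≠ ⊤) : ∃ d : ℕ, 1 ≤ d ∧ x.1.death = ((d : ℝ) : WithTop ℝ) := by
  obtain ⟨r, hr⟩ := WithTop.ne_top_iff_exists.mp hx
  have hbr : x.1.birth < r := by
    have := x.1.birth_lt_death
    rwa [← hr, WithTop.coe_lt_coe] at this
  -- With equal integral parts the structure map would be injective and the bar would still be alive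
  -- at `r`.
  have hlt : ∀ s, x.1.birth ≤ s → s < r → ⌊s⌋₊ < ⌊r⌋₊ := fun s hs hsr => by
    refine lt_of_le_of_ne (Nat.floor_mono hsr.le) fun hfl => ?_
    have hr' := hB.mem_of_injective (homOfLE hsr.le) (fun z hz => E.injective s (by
      rw [map_zero]
      refine homologyMap_injective_of_eq F (𝒦.step_mono (Nat.floor_mono hsr.le)) (by rw [hfl]) ?_
      rw [← E.natural s r (homOfLE hsr.le), hz, map_zero])) (x := x)
      ⟨hs, by rw [← hr]; exact WithTop.coe_lt_coe.mpr hsr⟩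
    have h2 := hr'.2
    rw [← hr] at h2
    exact lt_irrefl _ h2
  have hd : 1 ≤ ⌊r⌋₊ := (Nat.zero_le _).trans_lt (hlt _ le_rfl hbr)
  refine ⟨⌊r⌋₊, hd, ?_⟩
  have h1 : (⌊r⌋₊ : ℝ) ≤ r := Nat.floor_le (Nat.pos_of_floor_pos hd).le
  have h2 : ¬ (⌊r⌋₊ : ℝ) < r := fun h => by
    have h3 := hlt _ (le_max_left _ (⌊r⌋₊ : ℝ)) (max_lt hbr h)
    have h4 := Nat.floor_mono (le_max_right x.1.birth (⌊r⌋₊ : ℝ))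
    rw [Nat.floor_natCast] at h4
    omega
  rw [← hr, le_antisymm h1 (not_lt.mp h2)]

/-- Before a positive integer `d`, there are indices with integral part `d - 1` that are larger than
given numbers smaller than `d`. -/
theorem exists_floor_add_one_eq {d : ℕ} (hd : 1 ≤ d) {b b' : ℝ} (hb : b < d) (hb' : b' < d) :
    ∃ s : ℝ, b ≤ s ∧ b' ≤ s ∧ s < d ∧ ⌊s⌋₊ + 1 = d := by
  have hdd : ((d - 1 : ℕ) : ℝ) < d := Nat.cast_lt.mpr (by omega)
  -- Births have not been shown to be integers, so `d - 1` alone might precede them.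
  refine ⟨max (max b b') ((d - 1 : ℕ) : ℝ), (le_max_left _ _).trans (le_max_left _ _),
    (le_max_right _ _).trans (le_max_left _ _), max_lt (max_lt hb hb') hdd, ?_⟩
  have h1 := Nat.floor_mono (le_max_right (max b b') ((d - 1 : ℕ) : ℝ))
  rw [Nat.floor_natCast] at h1
  have h2 := (Nat.floor_lt' (a := max (max b b') ((d - 1 : ℕ) : ℝ)) (n := d) (by omega)).mpr
    (max_lt (max_lt hb hb') hdd)
  omega

theorem birth_lt_of_death_eq {x : B.ToType} {d : ℕ} (hx : x.1.death = ((d : ℝ) : WithTop ℝ)) :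
    x.1.birth < d := by
  have := x.1.birth_lt_death
  rwa [hx, WithTop.coe_lt_coe] at this

theorem mem_of_death_eq {x : B.ToType} {d : ℕ} (hx : x.1.death = ((d : ℝ) : WithTop ℝ)) {s : ℝ}
    (hs : x.1.birth ≤ s) (hsd : s < d) : s ∈ x.1.toSet :=
  ⟨hs, by rw [hx]; exact WithTop.coe_lt_coe.mpr hsd⟩

theorem notMem_of_death_eq {x : B.ToType} {d : ℕ} (hx : x.1.death = ((d : ℝ) : WithTop ℝ)) :
    (d : ℝ) ∉ x.1.toSet := fun h => by
  have h2 := h.2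
  rw [hx] at h2
  exact lt_irrefl _ h2

/-- At most one bar dies at each step. -/
theorem eq_of_death_eq (E : 𝒦.HomologyEmbedding p M) (hB : IsBarcode M B) {d : ℕ} (hd : 1 ≤ d)
    {x y : B.ToType} (hx : x.1.death = ((d : ℝ) : WithTop ℝ))
    (hy : y.1.death = ((d : ℝ) : WithTop ℝ)) : x = y := by
  obtain ⟨s, hxs, hys, hsd, hfl⟩ :=
    exists_floor_add_one_eq hd (birth_lt_of_death_eq hx) (birth_lt_of_death_eq hy)
  refine hB.eq_of_kernel (homOfLE hsd.le) (fun z z' hz hz' => ?_) (mem_of_death_eq hx hxs hsd)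
    (mem_of_death_eq hy hys hsd) (notMem_of_death_eq hx) (notMem_of_death_eq hy)
  have h0 : ∀ u, (M.map (homOfLE hsd.le)).hom u = 0 →
      homologyMap F (𝒦.step_mono (Nat.floor_mono hsd.le)) p (E.toFun s u) = 0 := fun u hu => by
    rw [← E.natural s d (homOfLE hsd.le), hu, map_zero]
  obtain ⟨a, a', ha, h⟩ := exists_linear_relation_of_homologyMap_eq_zero F _
    (𝒦.subsingleton_faces_diff hfl) (h0 z hz) (h0 z' hz')
  refine ⟨a, a', ha, E.injective s ?_⟩
  rw [map_add, map_smul, map_smul, h, map_zero]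

/-- The death of a bar is caused by the insertion of a simplex, the boundary of which spans the
classes that die. -/
theorem exists_simplex_of_death_eq (E : 𝒦.HomologyEmbedding p M) (hB : IsBarcode M B) {d : ℕ}
    (hd : 1 ≤ d) {x : B.ToType} (hx : x.1.death = ((d : ℝ) : WithTop ℝ)) :
    ∃ s : ℝ, ⌊s⌋₊ + 1 = d ∧ ∃ z : M.obj s, E.toFun s z ≠ 0 ∧ ∃ τ : Finset V,
      (𝒦.step (⌊s⌋₊ + 1)).faces \ (𝒦.step ⌊s⌋₊).faces = {τ} ∧ τ.card = p + 2 ∧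
      ∀ hτ : simplexBoundary F τ ∈ cycles F (𝒦.step ⌊s⌋₊) p,
        ∃ a : F, E.toFun s z = a • homologyClass F _ p _ hτ := by
  obtain ⟨s, hxs, -, hsd, hfl⟩ :=
    exists_floor_add_one_eq hd (birth_lt_of_death_eq hx) (birth_lt_of_death_eq hx)
  obtain ⟨z, hz, hz0⟩ : ∃ z, (M.map (homOfLE hsd.le)).hom z = 0 ∧ z ≠ 0 := by
    by_contra! h
    exact notMem_of_death_eq hx
      (hB.mem_of_injective (homOfLE hsd.le) h (mem_of_death_eq hx hxs hsd))
  have hEz : E.toFun s z ≠ 0 := fun h => hz0 (E.injective s (h.trans (map_zero _).symm))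
  have h0 : homologyMap F (𝒦.step_mono (Nat.floor_mono hsd.le)) p (E.toFun s z) = 0 := by
    rw [← E.natural s d (homOfLE hsd.le), hz, map_zero]
  obtain ⟨τ, hτ, hcard, H⟩ := (eq_zero_or_eq_smul_of_homologyMap_eq_zero F _
    (𝒦.subsingleton_faces_diff hfl) h0).resolve_left hEz
  rw [Nat.floor_natCast, ← hfl] at hτ
  exact ⟨s, hfl, z, hEz, τ, hτ, hcard, H⟩

/-- If a non-zero class in degree `n` vanishes in degree `n + 1`, then some bar dies at `n + 1`. -/
theorem exists_death_eq_of_kernel (E : 𝒦.HomologyEmbedding p M) (hB : IsBarcode M B) {n : ℕ}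
    (g : (n : ℝ) ⟶ ((n + 1 : ℕ) : ℝ)) {z : M.obj (n : ℝ)} (hz : z ≠ 0)
    (hgz : (M.map g).hom z = 0) :
    ∃ x : B.ToType, x.1.death = (((n + 1 : ℕ) : ℝ) : WithTop ℝ) := by
  obtain ⟨x, hx, hx'⟩ := hB.exists_mem_of_kernel g hz hgz
  -- The death lies in `(n, n + 1]` and is an integer.
  have hle : x.1.death ≤ (((n + 1 : ℕ) : ℝ) : WithTop ℝ) :=
    not_lt.mp fun h => hx' ⟨hx.1.trans (leOfHom g), h⟩
  obtain ⟨d, -, hd⟩ := E.exists_death_eq hB x (hle.trans_lt (WithTop.coe_lt_top _)).ne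
  have h2 := hx.2
  rw [hd, WithTop.coe_le_coe, Nat.cast_le] at hle
  rw [hd, WithTop.coe_lt_coe, Nat.cast_lt] at h2
  exact ⟨x, by rw [hd, show d = n + 1 by omega]⟩

end HomologyEmbedding

end SimplexwiseFiltration

/-! ### Death simplices, matchings and cuts -/

namespace SimplexwiseFiltration

variable {V : Type*} {K : PreAbstractSimplicialComplex V} [LinearOrder V] {F : Type*} [Field F]

/-- The image of `PH_p(𝒦 - A)` in `PH_p(𝒦)` has a bar that dies at the insertion of `τ` if and only
if the class of `∂τ` is in the image. -/
theorem exists_death_imageModule_iff (𝒦 : SimplexwiseFiltration K) (p : ℕ) (A : Set (Finset V))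
    {n : ℕ} {τ : Finset V} (hτ : (𝒦.step (n + 1)).faces \ (𝒦.step n).faces = {τ})
    (hcard : τ.card = p + 2) (hcyc : simplexBoundary F τ ∈ cycles F (𝒦.step n) p)
    (hne : homologyClass F (𝒦.step n) p _ hcyc ≠ 0) :
    (∃ y : (barcode (imageModule (𝒦.deletePHMap F p A))).ToType,
      y.1.death = (((n + 1 : ℕ) : ℝ) : WithTop ℝ)) ↔
    homologyClass F (𝒦.step n) p _ hcyc ∈
      LinearMap.range (homologyMap F (delete_le (𝒦.step n) A) p) := by
  have hB := 𝒦.isBarcode_imageModule (F := F) p A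
  let E := 𝒦.imageEmbedding F p A
  constructor
  · rintro ⟨y, hy⟩
    obtain ⟨s, hs, z, hz, τ', hτ', -, H⟩ := E.exists_simplex_of_death_eq hB (by omega) hy
    obtain rfl : ⌊s⌋₊ = n := by omega
    obtain rfl : τ' = τ := Set.singleton_injective (hτ'.symm.trans hτ)
    obtain ⟨a, ha⟩ := H hcyc
    -- The dying element of the image is a nonzero multiple of [∂τ], so [∂τ] itself is in the image.
    have ha0 : a ≠ 0 := fun h => hz (by rw [ha, h, zero_smul])
    have hmem : E.toFun s z ∈ LinearMap.range (homologyMap F (delete_le (𝒦.step ⌊s⌋₊) A) p) := z.2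
    rw [ha] at hmem
    exact (Submodule.smul_mem_iff _ ha0).mp hmem
  · intro h
    have hfl : ⌊(n : ℝ)⌋₊ = n := Nat.floor_natCast n
    -- The cycle proof is bundled with the claims about the class because its type also changes when
    -- `⌊(n : ℝ)⌋₊` is rewritten to `n`.
    have key : ∃ hcyc' : simplexBoundary F τ ∈ cycles F (𝒦.step ⌊(n : ℝ)⌋₊) p,
        homologyClass F (𝒦.step ⌊(n : ℝ)⌋₊) p _ hcyc' ∈
          LinearMap.range (homologyMap F (delete_le (𝒦.step ⌊(n : ℝ)⌋₊) A) p) ∧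
        homologyClass F (𝒦.step ⌊(n : ℝ)⌋₊) p _ hcyc' ≠ 0 := by
      rw [hfl]
      exact ⟨hcyc, h, hne⟩
    obtain ⟨hcyc', hmem, hne'⟩ := key
    have hle : (n : ℝ) ≤ ((n + 1 : ℕ) : ℝ) := Nat.cast_le.mpr (Nat.le_succ n)
    refine E.exists_death_eq_of_kernel hB (homOfLE hle) (z := ⟨_, hmem⟩)
      (fun h0 => hne' (congrArg Subtype.val h0)) (Subtype.ext ?_)
    refine homologyMap_simplexBoundary F (𝒦.step_mono (Nat.floor_mono hle)) ?_ hcard hcyc'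
    rw [Nat.floor_natCast]
    have hmemτ : τ ∈ (𝒦.step (n + 1)).faces \ (𝒦.step n).faces := hτ ▸ rfl
    exact hmemτ.1

/-- A finite death of a bar of `PH_p(𝒦)` is caused by the insertion of a simplex with a boundary
that is not homologous to zero before. -/
theorem exists_simplex_of_death_PH {𝒦 : SimplexwiseFiltration K} {p d : ℕ} (hd : 1 ≤ d)
    {B : (barcode (𝒦.PH F p)).ToType} (hB : B.1.death = ((d : ℝ) : WithTop ℝ)) :
    ∃ n, n + 1 = d ∧ ∃ τ : Finset V, (𝒦.step (n + 1)).faces \ (𝒦.step n).faces = {τ} ∧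
      τ.card = p + 2 ∧ ∃ hcyc : simplexBoundary F τ ∈ cycles F (𝒦.step n) p,
        homologyClass F (𝒦.step n) p _ hcyc ≠ 0 := by
  obtain ⟨s, hs, z, hz, τ, hτ, hcard, H⟩ :=
    (𝒦.phEmbedding F p).exists_simplex_of_death_eq (𝒦.isBarcode_PH p) hd hB
  have hcyc := simplexBoundary_mem_cycles F hτ hcard
  obtain ⟨a, ha⟩ := H hcyc
  exact ⟨_, hs, τ, hτ, hcard, hcyc, fun h => hz (by rw [ha, h, smul_zero])⟩

/-- A bar of `PH_p(𝒦)` with finite death is matched by `PH_p(𝒦 - A) ⟶ PH_p(𝒦)` if and only if the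
class of the boundary of the death simplex comes from the predeath complex minus `A`. -/
theorem exists_inducedMatching_deletePHMap_iff (𝒦 : SimplexwiseFiltration K) (p : ℕ)
    (A : Set (Finset V)) {n : ℕ} {τ : Finset V} {B : (barcode (𝒦.PH F p)).ToType}
    (hB : B.1.death = (((n + 1 : ℕ) : ℝ) : WithTop ℝ))
    (hτ : (𝒦.step (n + 1)).faces \ (𝒦.step n).faces = {τ})
    (hcard : τ.card = p + 2) (hcyc : simplexBoundary F τ ∈ cycles F (𝒦.step n) p)
    (hne : homologyClass F (𝒦.step n) p _ hcyc ≠ 0) :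
    (∃ B' : (barcode ((𝒦.delete A).PH F p)).ToType,
      InducedMatching (𝒦.deletePHMap F p A) B' B) ↔
    homologyClass F (𝒦.step n) p _ hcyc ∈
      LinearMap.range (homologyMap F (delete_le (𝒦.step n) A) p) := by
  rw [← 𝒦.exists_death_imageModule_iff p A hτ hcard hcyc hne, ← hB]
  refine exists_inducedMatching_iff _ ((𝒦.delete A).isBarcode_PH p)
    (𝒦.isBarcode_imageModule p A) B (fun z hz => ?_) fun y y' hy hy' => ?_
  · exact (𝒦.phEmbedding F p).eq_of_death_eq (𝒦.isBarcode_PH p) (Nat.le_add_left 1 n)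
      (hz.trans hB) hB
  · exact (𝒦.imageEmbedding F p A).eq_of_death_eq (𝒦.isBarcode_imageModule p A)
      (Nat.le_add_left 1 n) (hy.trans hB) (hy'.trans hB)

/-- A class comes from the complement of every set of at most `k` simplices of dimension `s` if and
only if its homological `s`-cuts have more than `k` elements. -/
theorem forall_mem_range_iff_forall_cut (𝒦 : SimplexwiseFiltration K) (p s k n : ℕ)
    (γ : Homology F (𝒦.step n) p) :
    (∀ A : Finset (Finset V), (A : Set (Finset V)) ⊆ simplices K s → A.card ≤ k →
      γ ∈ LinearMap.range (homologyMap F (delete_le (𝒦.step n) (A : Set (Finset V))) p)) ↔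
    ∀ C : Finset (Finset V), IsHomologicalCut F (𝒦.step n) p s γ C → k < C.card := by
  classical
  constructor
  · intro h C hC
    by_contra hk
    exact hC.2 (h C (fun σ hσ => ⟨𝒦.step_le n (hC.1 hσ).1, (hC.1 hσ).2⟩) (not_lt.mp hk))
  · intro h A hA hk
    -- `A` may contain simplices inserted later, which a cut may not. Dropping them changes no
    -- deletion at step `n`, since a nonempty face of a simplex of the complex is in the complex,
    -- and it does not increase the size.
    let C : Finset (Finset V) := A.filter (· ∈ (𝒦.step n).faces)
    have hC : (C : Set (Finset V)) = (A : Set (Finset V)) ∩ (𝒦.step n).faces :=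
      Finset.coe_filter _ _
    have hdel : AdvRobust.delete (𝒦.step n) (C : Set (Finset V)) =
        AdvRobust.delete (𝒦.step n) (A : Set (Finset V)) := by
      rw [hC]
      refine delete_inter_faces _ fun a ha => Finset.card_pos.mp ?_
      rw [(hA ha).2]
      exact Nat.succ_pos s
    have hmem : γ ∈
        LinearMap.range (homologyMap F (delete_le (𝒦.step n) (C : Set (Finset V))) p) := by
      by_contra hγ
      refine absurd (h C ⟨fun σ hσ => ?_, hγ⟩)
        (not_lt.mpr ((Finset.card_filter_le _ _).trans hk))
      rw [hC] at hσ
      exact ⟨hσ.2, (hA hσ.1).2⟩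
    obtain ⟨z, rfl⟩ := hmem
    refine ⟨homologyMap F hdel.le p z, ?_⟩
    rw [homologyMap_homologyMap]

end SimplexwiseFiltration

end AdvRobust

end

/-! ### The main theorem -/

theorem mainTheorem4 {V : Type*} [LinearOrder V] (F : Type*) [Field F]
    {K : PreAbstractSimplicialComplex V} (𝒦 : AdvRobust.SimplexwiseFiltration K)
    (p s k : ℕ) (hs : s ≤ p)
    (B : (AdvRobust.barcode (𝒦.PH F p)).ToType) (hB : B.1.death ≠ ⊤) :
    (∃! q : ℕ × Finset V, 𝒦.IsDeathSimplex B.1 q.1 q.2) ∧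
    ∀ (d : ℕ) (τ : Finset V), 𝒦.IsDeathSimplex B.1 d τ →
      ∃ hτ : AdvRobust.simplexBoundary F τ ∈ AdvRobust.cycles F (𝒦.step (d - 1)) p,
        (𝒦.IsAdversariallyRobust F p k s B ↔
          ∀ A : Finset (Finset V), (A : Set (Finset V)) ⊆ AdvRobust.simplices K s → A.card ≤ k →
            AdvRobust.homologyClass F (𝒦.step (d - 1)) p (AdvRobust.simplexBoundary F τ) hτ ∈
              LinearMap.range (AdvRobust.homologyMap F
                (AdvRobust.delete_le (𝒦.step (d - 1)) (A : Set (Finset V))) p)) ∧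
        (𝒦.IsAdversariallyRobust F p k s B ↔
          ∀ C : Finset (Finset V),
            AdvRobust.IsHomologicalCut F (𝒦.step (d - 1)) p s
              (AdvRobust.homologyClass F (𝒦.step (d - 1)) p
                (AdvRobust.simplexBoundary F τ) hτ) C →
            k < C.card) := by
  constructor
  · obtain ⟨d, hd, hBd⟩ := (𝒦.phEmbedding F p).exists_death_eq (𝒦.isBarcode_PH p) B hB
    obtain ⟨n, rfl, τ, hτ, -⟩ := AdvRobust.SimplexwiseFiltration.exists_simplex_of_death_PH hd hBd
    refine ⟨(n + 1, τ), ⟨hBd, hd, hτ⟩, ?_⟩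
    rintro ⟨d', τ'⟩ ⟨hBd', -, hτ'⟩
    obtain rfl : d' = n + 1 := Nat.cast_injective (WithTop.coe_injective (hBd'.symm.trans hBd))
    exact Prod.ext rfl (Set.singleton_injective (hτ'.symm.trans hτ))
  · rintro d τ ⟨hBd, hd, hτ⟩
    obtain ⟨n, rfl, τ', hτ', hcard, hcyc, hne⟩ :=
      AdvRobust.SimplexwiseFiltration.exists_simplex_of_death_PH hd hBd
    obtain rfl : τ' = τ := Set.singleton_injective (hτ'.symm.trans hτ)
    have h12 : 𝒦.IsAdversariallyRobust F p k s B ↔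
        ∀ A : Finset (Finset V), (A : Set (Finset V)) ⊆ AdvRobust.simplices K s → A.card ≤ k →
          AdvRobust.homologyClass F (𝒦.step n) p (AdvRobust.simplexBoundary F τ') hcyc ∈
            LinearMap.range (AdvRobust.homologyMap F
              (AdvRobust.delete_le (𝒦.step n) (A : Set (Finset V))) p) :=
      -- The matching criterion holds for each deleted set separately; the bound on its size plays
      -- no role.
      forall_congr' fun A => forall_congr' fun _ => forall_congr' fun _ =>
        𝒦.exists_inducedMatching_deletePHMap_iff p A hBd hτ' hcard hcyc hne
    exact ⟨hcyc, h12, h12.trans (𝒦.forall_mem_range_iff_forall_cut p s k n _)⟩
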